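/- Let $\mathcal A$ be a locally finitely presentable category, and let $\iota\colon \mathcal A_f \to \mathcal A$ be a fully faithful functor from a small category whose essential image consists of the finitely presentable objects; $\iota$ is omitted from the notation. A Lawvere $\mathcal A$-theory is a small category $\mathcal L$ with an identity-on-objects, finite-limit-preserving functor $J\colon \mathcal A_f^{\mathrm{op}}\to\mathcal L$; a morphism of theories is a functor commuting strictly with the functors $J$. Write $\mathrm{Mnd}_f(\mathcal A)$ for the category of finitary (filtered-colimit-preserving) monads on $\mathcal A$ and $\mathrm{Law}(\mathcal A)$ for the category of Lawvere $\mathcal A$-theories. Let $\mathrm{LexProf}$ be the bicategory whose objects are small finitely complete categories, whose 1-cells $M\colon\mathbb A\to\mathbb B$ are functors $\mathbb A^{\mathrm{op}}\to \mathrm{FL}(\mathbb B,\mathrm{Set})$ (where $\mathrm{FL}$ denotes finite-limit-preserving functors), with composition $(N\otimes M)(a,c)=\int^b N(b,c)\times M(a,b)$. A monad $T$ on $\mathbb A$ in $\mathrm{LexProf}$ is the same as a one-object $\mathrm{LexProf}$-category $\mathcal T$ of extent $\mathbb A$, and acts as a monad $X\mapsto\int^{a}T(a,-)\times Xa$ on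 $\mathrm{FL}(\mathbb A,\mathrm{Set})$. For a $\mathrm{LexProf}$-category $\mathcal C$, let $\int\mathcal C$ be its free completion under absolute tensors: the category whose objects are pairs $(X,i)$ with $X\in\mathcal C$ and $i$ an object of the extent of $X$, and with hom-sets $\int\mathcal C((X,i),(Y,j))=\mathcal C(X,Y)(i,j)$, equipped with the left-exact sieve generated by the functors $i\mapsto (X,i)$. Applying $\int$ to the unique enriched functor to $\mathcal T$ from the one-object $\mathrm{LexProf}$-category of the identity monad on $\mathbb A$ gives an identity-on-objects functor $J_{\mathcal T}\colon\mathbb A\to\int\mathcal T$. The functor $N\colon\mathcal A\to\mathrm{FL}(\mathcal A_f^{\mathrm{op}},\mathrm{Set})$, $X\mapsto\mathcal A(-,X)$, is an equivalence. By a *transport* we mean a functor $\Phi$ from $\mathrm{Mnd}_f(\mathcal A)$ to the category of monads on $\mathcal A_f^{\mathrm{op}}$ in $\mathrm{LexProf}$, together with isomorphisms, natural in $S$ and compatible with units and multiplications, between $NS$ and $T N$, where $T$ is the monad on $\mathrm{FL}(\mathcal A_f^{\mathrm{op}},\mathrm{Set})$ given by the action of $\Phi S$. There is a transport with $(\Phi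 S)(i,j)=\mathcal A(j,Si)$, whose unit and multiplication are induced by postcomposition with those of $S$. For every transport $\Phi$, the assignment $S\mapsto (J_{\mathcal T}\colon\mathcal A_f^{\mathrm{op}}\to\int\mathcal T)$, where $\mathcal T$ is the one-object $\mathrm{LexProf}$-category of $\Phi S$ and the sieve on $\int\mathcal T$ is forgotten, is an equivalence of categories $\mathrm{Mnd}_f(\mathcal A)\to\mathrm{Law}(\mathcal A)$. It agrees, that is, is naturally isomorphic, with the Nishizawa–Power equivalence, which sends $S$ to the theory $\mathcal L_S$ with the objects of $\mathcal A_f^{\mathrm{op}}$, hom-sets $\mathcal L_S(i,j)=\mathcal A(j,Si)$, Kleisli composition, and $J$ sending $f\in\mathcal A_f(j,i)$ to $\eta_i\circ f$, and which is an equivalence. For the explicit transport above, the natural isomorphism can be chosen to be the identity on all the hom-sets $\mathcal A(j,Si)$. -/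

import Mathlib

open CategoryTheory Limits Opposite Bicategory

universe t w v u

namespace LexProf

/-- A small category with finite limits. -/
structure LexCat : Type (w + 1) where
  carrier : Type w
  [cat : SmallCategory carrier]
  [lim : HasFiniteLimits carrier]

attribute [instance] LexCat.cat LexCat.lim

instance : CoeSort LexCat.{w} (Type w) := ⟨LexCat.carrier⟩

/-- `FL(A, Set)`: finite-limit-preserving functors `A ⥤ Set`. -/
abbrev FL (A : LexCat.{w}) : Type (w + 1) := A ⥤ₗ Type w

instance (A : LexCat.{w}) (X : FL A) : PreservesFiniteLimits X.obj := X.property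

/-- A lex profunctor from `A` to `B`: a functor `Aᵒᵖ ⥤ FL(B, Set)`, that is, a functor
`M : Aᵒᵖ × B → Set` preserving finite limits in the second variable. -/
abbrev Prof (A B : LexCat.{w}) : Type (w + 1) := Aᵒᵖ ⥤ FL B

/-- The set `M(a, b)`. -/
abbrev Prof.at {A B : LexCat.{w}} (M : Prof A B) (a : A) (b : B) : Type w :=
  (M.obj (op a)).obj.obj b

/-- The contravariant action of `M` in its first variable. -/
abbrev Prof.lmap {A B : LexCat.{w}} (M : Prof A B) {a a' : A} (f : a ⟶ a') {b : B}
    (m : M.at a' b) : M.at a b := (M.map f.op).hom.app b m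

/-- The covariant action of `M` in its second variable. -/
abbrev Prof.rmap {A B : LexCat.{w}} (M : Prof A B) {a : A} {b b' : B} (g : b ⟶ b')
    (m : M.at a b) : M.at a b' := (M.obj (op a)).obj.map g m

/-- A component of a 2-cell of lex profunctors. -/
abbrev Prof.app {A B : LexCat.{w}} {M N : Prof A B} (α : M ⟶ N) {a : A} {b : B}
    (m : M.at a b) : N.at a b := (α.app (op a)).hom.app b m

section Tensor

variable {A B C D : LexCat.{w}}

/-- The bifunctor `(b, b') ↦ N(b, c) × X b'`. -/
def integrand (N : Prof B C) (X : B ⥤ Type w) (c : C) :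
    (B : Type w)ᵒᵖ ⥤ B ⥤ Type w where
  obj b :=
    { obj := fun b' => (N.obj b).obj.obj c × X.obj b'
      map := fun f => ↾fun p => (p.1, X.map f p.2) }
  map g := { app := fun _ => ↾fun p => ((N.map g).hom.app c p.1, p.2) }

/-- The coend `∫^b N(b, c) × X b`. -/
abbrev TensObj (N : Prof B C) (X : B ⥤ Type w) (c : C) : Type w :=
  Types.coend.{w, w, w} (integrand N X c)

/-- The class `[n, x]` of a pair in the coend. -/
def tmk (N : Prof B C) (X : B ⥤ Type w) {c : C} {b : B} (n : N.at b c) (x : X.obj b) :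
    TensObj N X c :=
  Quot.mk _ ⟨b, (n, x)⟩

lemma tmk_sound (N : Prof B C) (X : B ⥤ Type w) {c : C} {b b' : B} (f : b ⟶ b')
    (n : N.at b' c) (x : X.obj b) :
    tmk N X (N.lmap f n) x = tmk N X n (X.map f x) :=
  Quot.sound (Types.coendRel.mk (F := integrand N X c) f (n, x))

lemma tens_ind {N : Prof B C} {X : B ⥤ Type w} {c : C} {P : TensObj N X c → Prop}
    (h : ∀ (b : B) (n : N.at b c) (x : X.obj b), P (tmk N X n x)) (t : TensObj N X c) : P t := by
  obtain ⟨b, n, x⟩ := t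
  exact h b n x

/-- Functions out of the coend are dinatural families. -/
def tlift {N : Prof B C} {X : B ⥤ Type w} {c : C} {Z : Type w}
    (φ : ∀ b : B, N.at b c → X.obj b → Z)
    (hφ : ∀ (b b' : B) (f : b ⟶ b') (n : N.at b' c) (x : X.obj b),
      φ b (N.lmap f n) x = φ b' n (X.map f x)) :
    TensObj N X c → Z :=
  Quot.lift (fun t => φ t.1 t.2.1 t.2.2) (by
    rintro _ _ ⟨f, p⟩
    exact hφ _ _ f p.1 p.2)

lemma Prof.lmap_rmap (M : Prof A B) {a a' : A} (f : a ⟶ a') {b b' : B} (g : b ⟶ b')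
    (m : M.at a' b) : M.lmap f (M.rmap g m) = M.rmap g (M.lmap f m) :=
  ConcreteCategory.congr_hom ((M.map f.op).hom.naturality g) m

lemma Prof.rmap_id (M : Prof A B) {a : A} {b : B} (m : M.at a b) : M.rmap (𝟙 b) m = m := by
  simp [Prof.rmap]

lemma Prof.rmap_comp (M : Prof A B) {a : A} {b b' b'' : B} (f : b ⟶ b') (g : b' ⟶ b'')
    (m : M.at a b) : M.rmap (f ≫ g) m = M.rmap g (M.rmap f m) := by
  simp [Prof.rmap]

lemma Prof.lmap_id (M : Prof A B) {a : A} {b : B} (m : M.at a b) : M.lmap (𝟙 a) m = m := by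
  simp [Prof.lmap]

lemma Prof.lmap_comp (M : Prof A B) {a a' a'' : A} (f : a ⟶ a') (g : a' ⟶ a'') {b : B}
    (m : M.at a'' b) : M.lmap (f ≫ g) m = M.lmap f (M.lmap g m) := by
  simp [Prof.lmap]

lemma Prof.app_lmap {M N : Prof A B} (α : M ⟶ N) {a a' : A} (f : a ⟶ a') {b : B}
    (m : M.at a' b) : Prof.app α (M.lmap f m) = N.lmap f (Prof.app α m) :=
  ConcreteCategory.congr_hom (NatTrans.congr_app (congrArg (·.hom) (α.naturality f.op)) b) m

lemma Prof.app_rmap {M N : Prof A B} (α : M ⟶ N) {a : A} {b b' : B} (g : b ⟶ b')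
    (m : M.at a b) : Prof.app α (M.rmap g m) = N.rmap g (Prof.app α m) :=
  ConcreteCategory.congr_hom ((α.app (op a)).hom.naturality g) m

/-- The functor `c ↦ ∫^b N(b, c) × X b`. -/
def tens (N : Prof B C) (X : B ⥤ Type w) : C ⥤ Type w where
  obj c := TensObj N X c
  map g := ↾tlift (fun _ n x => tmk N X (N.rmap g n) x) (by
    intro b b' f n x
    rw [← tmk_sound, Prof.lmap_rmap])
  map_id c := by
    refine ConcreteCategory.hom_ext _ _ fun t => ?_
    induction t using tens_ind with
    | h b n x => exact congrArg (fun z => tmk N X z x) (N.rmap_id n)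
  map_comp f g := by
    refine ConcreteCategory.hom_ext _ _ fun t => ?_
    induction t using tens_ind with
    | h b n x => exact congrArg (fun z => tmk N X z x) (N.rmap_comp f g n)

/-- The diagram `(b, x) ↦ N(b, -)` on the opposite of the category of elements of `X`. -/
def elementsDiagram (N : Prof B C) (X : B ⥤ Type w) : C ⥤ X.Elementsᵒᵖ ⥤ Type w :=
  ((CategoryOfElements.π X).op ⋙ N ⋙ ObjectProperty.ι _).flip

noncomputable def tensIso (N : Prof B C) (X : B ⥤ Type w) :
    tens N X ≅ elementsDiagram N X ⋙ colim := by
  refine NatIso.ofComponents (fun c => Equiv.toIso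
    { toFun := tlift (fun b n x => colimit.ι ((elementsDiagram N X).obj c) (op ⟨b, x⟩) n) ?_
      invFun := colimit.desc ((elementsDiagram N X).obj c)
        { pt := TensObj N X c
          ι := { app := fun e => ↾fun n => tmk N X n e.unop.2
                 naturality := ?_ } }
      left_inv := ?_
      right_inv := ?_ }) ?_
  · intro b b' f n x
    have := ConcreteCategory.congr_hom (colimit.w ((elementsDiagram N X).obj c)
      (CategoryOfElements.homMk (F := X) ⟨b, x⟩ ⟨b', X.map f x⟩ f rfl).op) n
    exact this
  · intro e e' f
    refine ConcreteCategory.hom_ext _ _ fun n => ?_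
    have := tmk_sound N X f.unop.1 n e'.unop.2
    rw [f.unop.2] at this
    exact this
  · intro t
    induction t using tens_ind with
    | h b n x => exact ConcreteCategory.congr_hom (colimit.ι_desc (F := (elementsDiagram N X).obj c) _ (op ⟨b, x⟩)) n
  · intro t
    obtain ⟨e, n, rfl⟩ := Types.jointly_surjective' t
    refine (congrArg _ (ConcreteCategory.congr_hom (colimit.ι_desc (F := (elementsDiagram N X).obj c) _ e) n)).trans ?_
    rfl
  · intro c c' g
    refine ConcreteCategory.hom_ext _ _ fun t => ?_
    induction t using tens_ind with
    | h b n x =>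
      exact (ConcreteCategory.congr_hom (ι_colimMap ((elementsDiagram N X).map g) (op ⟨b, x⟩)) n).symm

lemma tens_preservesFiniteLimits (N : Prof B C) (X : B ⥤ Type w)
    [PreservesFiniteLimits X] : PreservesFiniteLimits (tens N X) := by
  have : HasFiniteLimits X.Elements := ⟨fun J _ _ => inferInstance⟩
  have : IsCofiltered X.Elements := IsCofiltered.of_hasFiniteLimits _
  have h1 : PreservesFiniteLimits (elementsDiagram N X) := by
    refine ⟨fun J _ _ => ?_⟩
    apply preservesLimitsOfShape_of_evaluation
    intro e
    have : PreservesFiniteLimits (N.obj (op e.unop.1)).obj := (N.obj (op e.unop.1)).property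
    exact inferInstanceAs (PreservesLimitsOfShape J (N.obj (op e.unop.1)).obj)
  have : PreservesFiniteLimits (elementsDiagram N X ⋙ colim) := comp_preservesFiniteLimits _ _
  exact preservesFiniteLimits_of_natIso (tensIso N X).symm

/-- The action `X ↦ (c ↦ ∫^b N(b, c) × X b)` of a lex profunctor. -/
def act (N : Prof B C) : FL B ⥤ FL C where
  obj X := ⟨tens N X.obj, tens_preservesFiniteLimits N X.obj⟩
  map {X Y} φ := ObjectProperty.homMk
    { app := fun c => ↾tlift (fun _ n x => tmk N Y.obj n (φ.hom.app _ x)) (by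
        intro b b' f n x
        rw [tmk_sound]
        congr 1
        exact (ConcreteCategory.congr_hom (φ.hom.naturality f) x).symm)
      naturality := by
        intro c c' g
        refine ConcreteCategory.hom_ext _ _ fun t => ?_
        induction t using tens_ind with
        | h b n x => rfl }
  map_id X := by
    refine ObjectProperty.hom_ext _ (NatTrans.ext (funext fun c =>
      ConcreteCategory.hom_ext _ _ fun t => ?_))
    induction t using tens_ind with
    | h b n x => rfl
  map_comp f g := by
    refine ObjectProperty.hom_ext _ (NatTrans.ext (funext fun c =>
      ConcreteCategory.hom_ext _ _ fun t => ?_))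
    induction t using tens_ind with
    | h b n x => rfl

/-- The natural transformation of actions induced by a 2-cell. -/
def actMap {N N' : Prof B C} (α : N ⟶ N') : act N ⟶ act N' where
  app X := ObjectProperty.homMk
    { app := fun c => ↾tlift (fun _ n x => tmk N' X.obj (Prof.app α n) x) (by
        intro b b' f n x
        rw [Prof.app_lmap, tmk_sound])
      naturality := by
        intro c c' g
        refine ConcreteCategory.hom_ext _ _ fun t => ?_
        induction t using tens_ind with
        | h b n x => exact congrArg (fun z => tmk N' X.obj z x) (Prof.app_rmap α g n) }
  naturality X Y φ := by
    refine ObjectProperty.hom_ext _ (NatTrans.ext (funext fun c =>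
      ConcreteCategory.hom_ext _ _ fun t => ?_))
    induction t using tens_ind with
    | h b n x => rfl

lemma FL.hom_ext {X Y : FL A} {f g : X ⟶ Y}
    (h : ∀ (a : A) (x : X.obj.obj a), f.hom.app a x = g.hom.app a x) : f = g :=
  ObjectProperty.hom_ext _ (NatTrans.ext (funext fun a =>
    ConcreteCategory.hom_ext _ _ fun x => h a x))

lemma Prof.hom_ext {M N : Prof A B} {α β : M ⟶ N}
    (h : ∀ (a : A) (b : B) (m : M.at a b), Prof.app α m = Prof.app β m) : α = β :=
  NatTrans.ext (funext fun a => FL.hom_ext fun b m => h a.unop b m)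

/-- The identity lex profunctor `(a, a') ↦ A(a, a')`. -/
def idProf (A : LexCat.{w}) : Prof A A where
  obj a := ⟨coyoneda.obj a, (inferInstance : PreservesFiniteLimits (coyoneda.obj a))⟩
  map f := ObjectProperty.homMk (coyoneda.map f)

/-- The composite `(a, c) ↦ ∫^b N(b, c) × M(a, b)`. -/
abbrev compProf (M : Prof A B) (N : Prof B C) : Prof A C := M ⋙ act N

/-- `∫^b N(b, -) × ∫^a M(a, b) × X a ≅ ∫^a (∫^b N(b, -) × M(a, b)) × X a`. -/
def actComp (M : Prof A B) (N : Prof B C) : act M ⋙ act N ≅ act (compProf M N) where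
  hom :=
    { app := fun X => ObjectProperty.homMk
        { app := fun c => ↾tlift (fun b n => tlift (fun a m x =>
              tmk (compProf M N) X.obj (b := a) (tmk N (M.obj (op a)).obj n m) x) (by
                intro a a' f m x
                exact tmk_sound (compProf M N) X.obj f (tmk N (M.obj (op a')).obj n m) x)) (by
              intro b b' f n t
              induction t using tens_ind with
              | h a m x =>
                exact congrArg (fun z => tmk (compProf M N) X.obj (b := a) z x)
                  (tmk_sound N (M.obj (op a)).obj f n m))
          naturality := by
            intro c c' g
            refine ConcreteCategory.hom_ext _ _ fun t => ?_
            induction t using tens_ind with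
            | h b n t =>
              induction t using tens_ind with
              | h a m x => rfl }
      naturality := by
        intro X Y φ
        refine FL.hom_ext fun c t => ?_
        induction t using tens_ind with
        | h b n t =>
          induction t using tens_ind with
          | h a m x => rfl }
  inv :=
    { app := fun X => ObjectProperty.homMk
        { app := fun c => ↾tlift (fun a (t : TensObj N (M.obj (op a)).obj c) x =>
              tlift (fun b n m => tmk N (tens M X.obj) n (tmk M X.obj (b := a) m x)) (by
                intro b b' f n m
                exact tmk_sound N (tens M X.obj) f n (tmk M X.obj (b := a) m x)) t) (by
              intro a a' f t x
              induction t using tens_ind with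
              | h b n m =>
                exact congrArg (fun z => tmk N (tens M X.obj) n z)
                  (tmk_sound M X.obj f m x))
          naturality := by
            intro c c' g
            refine ConcreteCategory.hom_ext _ _ fun t => ?_
            induction t using tens_ind with
            | h a t x =>
              induction t using tens_ind with
              | h b n m => rfl }
      naturality := by
        intro X Y φ
        refine FL.hom_ext fun c t => ?_
        induction t using tens_ind with
        | h a t x =>
          induction t using tens_ind with
          | h b n m => rfl }
  hom_inv_id := by
    refine NatTrans.ext (funext fun X => FL.hom_ext fun c t => ?_)
    induction t using tens_ind with
    | h b n t =>
      induction t using tens_ind with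
      | h a m x => rfl
  inv_hom_id := by
    refine NatTrans.ext (funext fun X => FL.hom_ext fun c t => ?_)
    induction t using tens_ind with
    | h a t x =>
      induction t using tens_ind with
      | h b n m => rfl

/-- `∫^a A(a, -) × X a ≅ X`. -/
def actId (A : LexCat.{w}) : act (idProf A) ≅ 𝟭 (FL A) where
  hom :=
    { app := fun X => ObjectProperty.homMk
        { app := fun c => ↾tlift (fun a (f : a ⟶ c) x => X.obj.map f x) (by
            intro a a' f (g : a' ⟶ c) x
            exact ConcreteCategory.congr_hom (X.obj.map_comp f g) x)
          naturality := by
            intro c c' g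
            refine ConcreteCategory.hom_ext _ _ fun t => ?_
            induction t using tens_ind with
            | h a f x => exact ConcreteCategory.congr_hom (X.obj.map_comp f g) x }
      naturality := by
        intro X Y φ
        refine FL.hom_ext fun c t => ?_
        induction t using tens_ind with
        | h a f x => exact (ConcreteCategory.congr_hom (φ.hom.naturality f) x).symm }
  inv :=
    { app := fun X => ObjectProperty.homMk
        { app := fun c => ↾fun x => tmk (idProf A) X.obj (b := c) (𝟙 c) x
          naturality := by
            intro c c' g
            refine ConcreteCategory.hom_ext _ _ fun x => ?_
            refine (tmk_sound (idProf A) X.obj g (𝟙 c') x).symm.trans ?_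
            refine congrArg (fun z => tmk (idProf A) X.obj (b := c) z x) ?_
            exact (Category.comp_id g).trans (Category.id_comp g).symm }
      naturality := by
        intro X Y φ
        rfl }
  hom_inv_id := by
    refine NatTrans.ext (funext fun X => FL.hom_ext fun c t => ?_)
    induction t using tens_ind with
    | h a f x =>
      refine (tmk_sound (idProf A) X.obj f (𝟙 c) x).symm.trans ?_
      exact congrArg (fun z => tmk (idProf A) X.obj (b := a) z x) (Category.comp_id f)
  inv_hom_id := by
    refine NatTrans.ext (funext fun X => FL.hom_ext fun c x => ?_)
    exact ConcreteCategory.congr_hom (X.obj.map_id c) x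

/-- `∫^a' M(a', b) × A(a, a') ≅ M(a, b)`. -/
def idComp (M : Prof A B) : compProf (idProf A) M ≅ M where
  hom :=
    { app := fun a => ObjectProperty.homMk
        { app := fun b => ↾tlift (fun a' (m : M.at a' b) (f : a.unop ⟶ a') => M.lmap f m) (by
            intro a' a'' f m (g : a.unop ⟶ a')
            exact (M.lmap_comp g f m).symm)
          naturality := by
            intro b b' g
            refine ConcreteCategory.hom_ext _ _ fun t => ?_
            induction t using tens_ind with
            | h a' m f => exact M.lmap_rmap f g m }
      naturality := by
        intro a a' k
        refine FL.hom_ext fun c t => ?_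
        induction t using tens_ind with
        | h a'' m f => exact M.lmap_comp k.unop f m }
  inv :=
    { app := fun a => ObjectProperty.homMk
        { app := fun b => ↾fun m => tmk M ((idProf A).obj a).obj (b := a.unop) m (𝟙 a.unop)
          naturality := by
            intro b b' g
            rfl }
      naturality := by
        intro a a' k
        refine FL.hom_ext fun b m => ?_
        refine (tmk_sound M ((idProf A).obj a').obj k.unop m (𝟙 a'.unop)).trans ?_
        refine congrArg (fun z => tmk M ((idProf A).obj a').obj (b := a.unop) m z) ?_
        exact (Category.id_comp k.unop).trans (Category.comp_id k.unop).symm }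
  hom_inv_id := by
    refine NatTrans.ext (funext fun a => FL.hom_ext fun b t => ?_)
    induction t using tens_ind with
    | h a' m f =>
      refine (tmk_sound M ((idProf A).obj a).obj f m (𝟙 a.unop)).trans ?_
      exact congrArg (fun z => tmk M ((idProf A).obj a).obj (b := a') m z) (Category.id_comp f)
  inv_hom_id := by
    refine NatTrans.ext (funext fun a => FL.hom_ext fun b m => ?_)
    exact M.lmap_id m

end Tensor

/-- The bicategory of lex profunctors. -/
instance : Bicategory LexCat.{w} where
  Hom A B := Prof A B
  id A := idProf A
  comp M N := compProf M N
  homCategory A B := inferInstanceAs (Category (Prof A B))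
  whiskerLeft M _ _ η := Functor.whiskerLeft M (actMap η)
  whiskerRight η N := Functor.whiskerRight η (act N)
  associator M N P := Functor.isoWhiskerLeft M (actComp N P)
  leftUnitor M := idComp M
  rightUnitor {_ B} M := Functor.isoWhiskerLeft M (actId B)
  whiskerLeft_id M N := by
    refine Prof.hom_ext fun a c t => ?_
    induction t using tens_ind with
    | h b n m => rfl
  whiskerLeft_comp M _ _ _ η θ := by
    refine Prof.hom_ext fun a c t => ?_
    induction t using tens_ind with
    | h b n m => rfl
  id_whiskerLeft {_ _ M N} η := by
    rw [← Category.assoc, Iso.eq_comp_inv]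
    refine Prof.hom_ext fun a c t => ?_
    induction t using tens_ind with
    | h b n f => exact (Prof.app_lmap η (a := a) (a' := b) f n).symm
  comp_whiskerLeft M N _ _ η := by
    refine Prof.hom_ext fun a c t => ?_
    induction t using tens_ind with
    | h b n t =>
      induction t using tens_ind with
      | h b' n' m => rfl
  id_whiskerRight M N := by
    refine Prof.hom_ext fun a c t => ?_
    induction t using tens_ind with
    | h b n m => rfl
  comp_whiskerRight η θ N := by
    refine Prof.hom_ext fun a c t => ?_
    induction t using tens_ind with
    | h b n m => rfl
  whiskerRight_id {_ _ M N} η := by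
    rw [← Category.assoc, Iso.eq_comp_inv]
    refine Prof.hom_ext fun a c t => ?_
    induction t using tens_ind with
    | h b f m => exact (Prof.app_rmap η (a := a) (b := b) f m).symm
  whiskerRight_comp η M N := by
    refine Prof.hom_ext fun a c t => ?_
    induction t using tens_ind with
    | h b t m =>
      induction t using tens_ind with
      | h b' n' m' => rfl
  whisker_assoc M _ _ η N := by
    refine Prof.hom_ext fun a c t => ?_
    induction t using tens_ind with
    | h b n t =>
      induction t using tens_ind with
      | h b' n' m => rfl
  whisker_exchange η θ := by
    refine Prof.hom_ext fun a c t => ?_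
    induction t using tens_ind with
    | h b n m => rfl
  pentagon M N P Q := by
    refine Prof.hom_ext fun a c t => ?_
    induction t using tens_ind with
    | h b n t =>
      induction t using tens_ind with
      | h b' n' t =>
        induction t using tens_ind with
        | h b'' n'' m => rfl
  triangle M N := by
    refine Prof.hom_ext fun a c t => ?_
    induction t using tens_ind with
    | h b n t =>
      induction t using tens_ind with
      | h b' f m => exact tmk_sound N (M.obj (op a)).obj f n m

section Enriched

/-- A category enriched in a bicategory `W`. The objects are indexed by their extent: `Obj x` is
the type of objects of extent `x`. -/
structure ECat (W : Type u) [Bicategory.{w, v} W] where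
  Obj : W → Type t
  hom {x y : W} (X : Obj x) (Y : Obj y) : x ⟶ y
  comp {x y z : W} (X : Obj x) (Y : Obj y) (Z : Obj z) : hom X Y ≫ hom Y Z ⟶ hom X Z
  iden {x : W} (X : Obj x) : 𝟙 x ⟶ hom X X
  id_comp {x y : W} (X : Obj x) (Y : Obj y) :
    iden X ▷ hom X Y ≫ comp X X Y = (λ_ (hom X Y)).hom
  comp_id {x y : W} (X : Obj x) (Y : Obj y) :
    hom X Y ◁ iden Y ≫ comp X Y Y = (ρ_ (hom X Y)).hom
  assoc {x y z a : W} (X : Obj x) (Y : Obj y) (Z : Obj z) (V : Obj a) :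
    comp X Y Z ▷ hom Z V ≫ comp X Z V =
      (α_ (hom X Y) (hom Y Z) (hom Z V)).hom ≫ hom X Y ◁ comp Y Z V ≫ comp X Y V

/-- A functor of `W`-categories. -/
structure EFunctor {W : Type u} [Bicategory.{w, v} W] (C D : ECat.{t} W) where
  obj {x : W} (X : C.Obj x) : D.Obj x
  map {x y : W} (X : C.Obj x) (Y : C.Obj y) : C.hom X Y ⟶ D.hom (obj X) (obj Y)
  map_iden {x : W} (X : C.Obj x) : C.iden X ≫ map X X = D.iden (obj X)
  map_comp {x y z : W} (X : C.Obj x) (Y : C.Obj y) (Z : C.Obj z) :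
    C.comp X Y Z ≫ map X Z =
      (map X Y ▷ C.hom Y Z ≫ D.hom (obj X) (obj Y) ◁ map Y Z) ≫ D.comp (obj X) (obj Y) (obj Z)

/-- A monad on `x` in the bicategory `W`. -/
structure MonadOn {W : Type u} [Bicategory.{w, v} W] (x : W) where
  hom : x ⟶ x
  unit : 𝟙 x ⟶ hom
  mul : hom ≫ hom ⟶ hom
  unit_mul : unit ▷ hom ≫ mul = (λ_ hom).hom
  mul_unit : hom ◁ unit ≫ mul = (ρ_ hom).hom
  assoc : mul ▷ hom ≫ mul = (α_ hom hom hom).hom ≫ hom ◁ mul ≫ mul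

/-- A morphism of monads on `x`. -/
@[ext]
structure MonadOn.Hom {W : Type u} [Bicategory.{w, v} W] {x : W} (S T : MonadOn x) where
  hom : S.hom ⟶ T.hom
  unit_hom : S.unit ≫ hom = T.unit
  mul_hom : S.mul ≫ hom = (hom ▷ S.hom ≫ T.hom ◁ hom) ≫ T.mul

instance {W : Type u} [Bicategory.{w, v} W] (x : W) : Category (MonadOn x) where
  Hom S T := MonadOn.Hom S T
  id S := ⟨𝟙 _, by simp, by simp⟩
  comp {S T U} f g := ⟨f.hom ≫ g.hom, by
      rw [← Category.assoc, f.unit_hom, g.unit_hom], by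
      rw [← Category.assoc, f.mul_hom, Category.assoc, g.mul_hom]
      simp [whisker_exchange_assoc]⟩
  id_comp f := MonadOn.Hom.ext (Category.id_comp _)
  comp_id f := MonadOn.Hom.ext (Category.comp_id _)
  assoc f g h := MonadOn.Hom.ext (Category.assoc _ _ _)

/-- The identity monad. -/
def MonadOn.one {W : Type u} [Bicategory.{w, v} W] (x : W) : MonadOn x where
  hom := 𝟙 x
  unit := 𝟙 _
  mul := (λ_ (𝟙 x)).hom
  unit_mul := by simp
  mul_unit := by simp [unitors_equal]
  assoc := by simp [unitors_equal]

/-- The unit of a monad, as the unique morphism from the identity monad. -/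
def MonadOn.fromOne {W : Type u} [Bicategory.{w, v} W] {x : W} (T : MonadOn x) :
    MonadOn.one x ⟶ T where
  hom := T.unit
  unit_hom := Category.id_comp _
  mul_hom := by
    change (λ_ (𝟙 x)).hom ≫ T.unit = (T.unit ▷ 𝟙 x ≫ T.hom ◁ T.unit) ≫ T.mul
    rw [Category.assoc, T.mul_unit, rightUnitor_naturality, unitors_equal]

/-- A single object, of extent `x`. -/
inductive Pt {W : Type u} (x : W) : W → Type
  | pt : Pt x x

/-- The `W`-category with a single object, of extent `x`, corresponding to a monad on `x`. -/
def MonadOn.toECat {W : Type u} [Bicategory.{w, v} W] {x : W} (T : MonadOn x) : ECat.{0} W where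
  Obj := Pt x
  hom := fun | .pt, .pt => T.hom
  comp := fun | .pt, .pt, .pt => T.mul
  iden := fun | .pt => T.unit
  id_comp := fun | .pt, .pt => T.unit_mul
  comp_id := fun | .pt, .pt => T.mul_unit
  assoc := fun | .pt, .pt, .pt, .pt => T.assoc

/-- The `W`-functor corresponding to a morphism of monads. -/
def MonadOn.Hom.toEFunctor {W : Type u} [Bicategory.{w, v} W] {x : W} {S T : MonadOn x}
    (f : S ⟶ T) : EFunctor S.toECat T.toECat where
  obj X := X
  map := fun | .pt, .pt => f.hom
  map_iden := fun | .pt => f.unit_hom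
  map_comp := fun | .pt, .pt, .pt => f.mul_hom

end Enriched

section Integral

/-- The objects `(X, i)` of `∫C`. -/
structure Integ (C : ECat.{t} LexCat.{w}) : Type (max t (w + 1)) where
  {ext : LexCat.{w}}
  obj : C.Obj ext
  idx : ext

variable (C : ECat.{t} LexCat.{w})

/-- Composition `C(Y, Z)(j, k) × C(X, Y)(i, j) → C(X, Z)(i, k)`. -/
def ECat.ecomp {A B D : LexCat.{w}} {X : C.Obj A} {Y : C.Obj B} {Z : C.Obj D} {i : A} {j : B}
    {k : D} (f : Prof.at (C.hom X Y) i j) (g : Prof.at (C.hom Y Z) j k) :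
    Prof.at (C.hom X Z) i k :=
  Prof.app (M := compProf (C.hom X Y) (C.hom Y Z)) (C.comp X Y Z)
    (tmk (C.hom Y Z) (Functor.obj (C.hom X Y) (op i)).obj g f)

/-- The identities map `A(i, j) → C(X, X)(i, j)`. -/
def ECat.eiota {A : LexCat.{w}} (X : C.Obj A) {i j : A} (φ : i ⟶ j) : Prof.at (C.hom X X) i j :=
  Prof.app (M := idProf A) (a := i) (b := j) (C.iden X) φ

variable {C}

lemma ECat.ecomp_assoc {A B D E : LexCat.{w}} {X : C.Obj A} {Y : C.Obj B} {Z : C.Obj D}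
    {V : C.Obj E} {i : A} {j : B} {k : D} {l : E} (f : Prof.at (C.hom X Y) i j)
    (g : Prof.at (C.hom Y Z) j k) (h : Prof.at (C.hom Z V) k l) :
    C.ecomp (C.ecomp f g) h = C.ecomp f (C.ecomp g h) :=
  congrArg (fun α => Prof.app (M := compProf (compProf (C.hom X Y) (C.hom Y Z)) (C.hom Z V)) α
    (tmk (C.hom Z V) (Functor.obj (compProf (C.hom X Y) (C.hom Y Z)) (op i)).obj h
      (tmk (C.hom Y Z) (Functor.obj (C.hom X Y) (op i)).obj g f))) (C.assoc X Y Z V)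

lemma ECat.eiota_ecomp {A B : LexCat.{w}} {X : C.Obj A} {Y : C.Obj B} {i i' : A} {j : B}
    (φ : i ⟶ i') (g : Prof.at (C.hom X Y) i' j) :
    C.ecomp (C.eiota X φ) g = Prof.lmap (C.hom X Y) φ g :=
  congrArg (fun α => Prof.app (M := compProf (idProf A) (C.hom X Y)) α
    (tmk (C.hom X Y) (Functor.obj (idProf A) (op i)).obj (b := i') g φ)) (C.id_comp X Y)

lemma ECat.ecomp_eiota {A B : LexCat.{w}} {X : C.Obj A} {Y : C.Obj B} {i : A} {j j' : B}
    (f : Prof.at (C.hom X Y) i j) (ψ : j ⟶ j') :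
    C.ecomp f (C.eiota Y ψ) = Prof.rmap (C.hom X Y) ψ f :=
  congrArg (fun α => Prof.app (M := compProf (C.hom X Y) (idProf B)) α
    (tmk (idProf B) (Functor.obj (C.hom X Y) (op i)).obj (c := j') (b := j) ψ f)) (C.comp_id X Y)

lemma ECat.eiota_comp {A : LexCat.{w}} (X : C.Obj A) {i j k : A} (φ : i ⟶ j) (ψ : j ⟶ k) :
    C.eiota X (φ ≫ ψ) = C.ecomp (C.eiota X φ) (C.eiota X ψ) := by
  rw [C.ecomp_eiota]
  exact Prof.app_rmap (M := idProf A) (C.iden X) (a := i) ψ φ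

/-- The category `∫C`, whose morphisms `(X, i) ⟶ (Y, j)` are the elements of `C(X, Y)(i, j)`. -/
instance : Category.{w} (Integ C) where
  Hom x y := Prof.at (C.hom x.obj y.obj) x.idx y.idx
  id x := C.eiota x.obj (𝟙 x.idx)
  comp f g := C.ecomp f g
  id_comp {x y} f := (C.eiota_ecomp (𝟙 x.idx) f).trans (Prof.lmap_id _ _)
  comp_id {x y} f := (C.ecomp_eiota f (𝟙 y.idx)).trans (Prof.rmap_id _ _)
  assoc f g h := C.ecomp_assoc f g h

/-- The functor `i ↦ (X, i)`. -/
def iota {A : LexCat.{w}} (X : C.Obj A) : A ⥤ Integ C where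
  obj i := ⟨X, i⟩
  map φ := C.eiota X φ
  map_id _ := rfl
  map_comp φ ψ := C.eiota_comp X φ ψ

lemma iota_preservesFiniteLimits {A : LexCat.{w}} (X : C.Obj A) :
    PreservesFiniteLimits (iota X) := by
  refine ⟨fun J _ _ => ⟨fun {K} => ⟨fun {c} hc => ⟨coyonedaJointlyReflectsLimits _ _ fun x => ?_⟩⟩⟩⟩
  let e : (Functor.obj (C.hom x.unop.obj X) (op x.unop.idx)).obj ≅ iota X ⋙ coyoneda.obj x :=
    NatIso.ofComponents (fun _ => Iso.refl _) (by
      intro i j φ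
      refine ConcreteCategory.hom_ext _ _ fun f => ?_
      exact (C.ecomp_eiota f φ).symm)
  have : PreservesFiniteLimits (iota X ⋙ coyoneda.obj x) := preservesFiniteLimits_of_natIso e
  exact isLimitOfPreserves (iota X ⋙ coyoneda.obj x) hc

/-- The functor `∫C ⥤ ∫D` induced by an enriched functor. -/
def integMap {C D : ECat.{t} LexCat.{w}} (F : EFunctor C D) : Integ C ⥤ Integ D where
  obj x := ⟨F.obj x.obj, x.idx⟩
  map {x y} f := Prof.app (F.map x.obj y.obj) f
  map_id x := congrArg (fun α => Prof.app (M := idProf x.ext) (a := x.idx) α (𝟙 x.idx))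
    (F.map_iden x.obj)
  map_comp {x y z} f g := congrArg (fun α =>
    Prof.app (M := compProf (C.hom x.obj y.obj) (C.hom y.obj z.obj)) α
      (tmk (C.hom y.obj z.obj) (Functor.obj (C.hom x.obj y.obj) (op x.idx)).obj g f))
    (F.map_comp x.obj y.obj z.obj)

end Integral

section Sieves

/-- A left-exact sieve on a category: a collection of finite-limit-preserving functors with small
finitely complete domains, closed under precomposition with finite-limit-preserving functors and
under isomorphism, and jointly surjective on objects. -/
structure LexSieve (C : Type u) [Category.{v} C] where
  mem {A : LexCat.{w}} : (A ⥤ C) → Prop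
  lex {A : LexCat.{w}} {X : A ⥤ C} : mem X → PreservesFiniteLimits X
  precomp {A B : LexCat.{w}} {X : B ⥤ C} (G : A ⥤ B) :
    mem X → PreservesFiniteLimits G → mem (G ⋙ X)
  of_iso {A : LexCat.{w}} {X Y : A ⥤ C} : mem X → (X ≅ Y) → mem Y
  exists_obj (c : C) : ∃ (A : LexCat.{w}) (X : A ⥤ C), mem X ∧ ∃ a : A, X.obj a = c

variable {C : Type*} [Category* C] {D : Type*} [Category* D]

/-- Partially finite-limit-preserving functors. -/
def IsPartiallyLex (S : LexSieve.{w} C) (S' : LexSieve.{w} D) (F : C ⥤ D) : Prop :=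
  ∀ {A : LexCat.{w}} (X : A ⥤ C), S.mem X → S'.mem (X ⋙ F)

/-- Sieve-reflecting functors. -/
def IsSieveReflecting (S : LexSieve.{w} C) (S' : LexSieve.{w} D) (F : C ⥤ D) : Prop :=
  ∀ {A : LexCat.{w}} (Y : A ⥤ D), S'.mem Y → ∃ X : A ⥤ C, S.mem X ∧ Nonempty (X ⋙ F ≅ Y)

/-- The sieve of all finite-limit-preserving functors into `B`. -/
def maxSieve (B : LexCat.{w}) : LexSieve.{w} B where
  mem X := PreservesFiniteLimits X
  lex h := h
  precomp G h h' := comp_preservesFiniteLimits G _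
  of_iso h e := preservesFiniteLimits_of_natIso e
  exists_obj b := ⟨B, 𝟭 B, inferInstance, b, rfl⟩

/-- The sieve on `∫C` generated by the functors `iota Y`. -/
def integSieve (C : ECat.{t} LexCat.{w}) : LexSieve.{w} (Integ C) where
  mem {A} X := ∃ (B : LexCat.{w}) (Y : C.Obj B) (F : A ⥤ B),
    PreservesFiniteLimits F ∧ Nonempty (X ≅ F ⋙ iota Y)
  lex := by
    rintro A X ⟨B, Y, F, hF, ⟨e⟩⟩
    have := iota_preservesFiniteLimits Y
    have := comp_preservesFiniteLimits F (iota Y)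
    exact preservesFiniteLimits_of_natIso e.symm
  precomp := by
    rintro A A' X G ⟨B, Y, F, hF, ⟨e⟩⟩ hG
    exact ⟨B, Y, G ⋙ F, comp_preservesFiniteLimits G F, ⟨Functor.isoWhiskerLeft G e⟩⟩
  of_iso := by
    rintro A X X' ⟨B, Y, F, hF, ⟨e⟩⟩ e'
    exact ⟨B, Y, F, hF, ⟨e'.symm ≪≫ e⟩⟩
  exists_obj x := ⟨x.ext, iota x.obj,
    ⟨x.ext, x.obj, 𝟭 _, inferInstance, ⟨(Functor.leftUnitor _).symm⟩⟩, x.idx, rfl⟩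

end Sieves


section Theories

/-- A category with the same objects as `B`, together with an identity-on-objects functor `J`
from `B` to it. Here `B` is small, and the hom-sets are small. -/
structure UnderId (B : LexCat.{w}) : Type (w + 1) where
  Hom : B → B → Type w
  id (i : B) : Hom i i
  comp {i j k : B} : Hom i j → Hom j k → Hom i k
  id_comp {i j : B} (f : Hom i j) : comp (id i) f = f
  comp_id {i j : B} (f : Hom i j) : comp f (id j) = f
  assoc {i j k l : B} (f : Hom i j) (g : Hom j k) (h : Hom k l) :
    comp (comp f g) h = comp f (comp g h)
  J {i j : B} : (i ⟶ j) → Hom i j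
  J_id (i : B) : J (𝟙 i) = id i
  J_comp {i j k : B} (f : i ⟶ j) (g : j ⟶ k) : J (f ≫ g) = comp (J f) (J g)

variable {B : LexCat.{w}}

/-- The objects of `L`: those of `B`. -/
structure UnderId.Obj (L : UnderId B) : Type w where
  of : B

instance (L : UnderId B) : SmallCategory L.Obj where
  Hom x y := L.Hom x.of y.of
  id x := L.id x.of
  comp f g := L.comp f g
  id_comp f := L.id_comp f
  comp_id f := L.comp_id f
  assoc f g h := L.assoc f g h

/-- The functor `J`. -/
def UnderId.functor (L : UnderId B) : B ⥤ L.Obj where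
  obj i := ⟨i⟩
  map f := L.J f
  map_id i := L.J_id i
  map_comp f g := L.J_comp f g

/-- A functor commuting (strictly) with the functors `J`; it is necessarily the identity on
objects. -/
@[ext]
structure UnderId.Mor (L M : UnderId B) where
  map {i j : B} : L.Hom i j → M.Hom i j
  map_id (i : B) : map (L.id i) = M.id i
  map_comp {i j k : B} (f : L.Hom i j) (g : L.Hom j k) :
    map (L.comp f g) = M.comp (map f) (map g)
  map_J {i j : B} (f : i ⟶ j) : map (L.J f) = M.J f

instance : Category (UnderId B) where
  Hom L M := UnderId.Mor L M
  id L := ⟨fun f => f, fun _ => rfl, fun _ _ => rfl, fun _ => rfl⟩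
  comp F G := ⟨fun f => G.map (F.map f), fun i => by rw [F.map_id, G.map_id],
    fun f g => by rw [F.map_comp, G.map_comp], fun f => by rw [F.map_J, G.map_J]⟩

/-- A morphism of `UnderId B`, as a functor. -/
def UnderId.Mor.functor {L M : UnderId B} (F : L ⟶ M) : L.Obj ⥤ M.Obj where
  obj x := ⟨x.of⟩
  map f := F.map f
  map_id x := F.map_id x.of
  map_comp f g := F.map_comp f g

/-- The category of Lawvere theories over `B`: small categories with a finite-limit-preserving,
identity-on-objects functor from `B`. -/
abbrev Law (B : LexCat.{w}) : Type (w + 1) :=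
  ObjectProperty.FullSubcategory (fun L : UnderId B => PreservesFiniteLimits L.functor)

/-- A Lawvere `LexProf`-category over `B`: a partially finitely complete category with a partially
finite-limit-preserving, identity-on-objects, sieve-reflecting functor from `B`. -/
structure LawLex (B : LexCat.{w}) : Type (w + 2) where
  toUnderId : UnderId B
  sieve : LexSieve.{w} toUnderId.Obj
  lex : IsPartiallyLex (maxSieve B) sieve toUnderId.functor
  refl : IsSieveReflecting (maxSieve B) sieve toUnderId.functor

/-- A morphism of Lawvere `LexProf`-categories. -/
@[ext]
structure LawLex.Mor (L M : LawLex B) where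
  hom : L.toUnderId ⟶ M.toUnderId
  lex : IsPartiallyLex L.sieve M.sieve (UnderId.Mor.functor hom)

instance : Category (LawLex B) where
  Hom L M := LawLex.Mor L M
  id L := ⟨𝟙 _, fun _ h => h⟩
  comp F G := ⟨F.hom ≫ G.hom, fun X h => G.lex _ (F.lex X h)⟩

/-- The functor from Lawvere `LexProf`-categories to Lawvere theories which forgets the sieve. -/
def forgetSieve (B : LexCat.{w}) : LawLex B ⥤ Law B where
  obj L := ⟨L.toUnderId, L.sieve.lex
    (L.lex (𝟭 B) (inferInstance : PreservesFiniteLimits (𝟭 (B : Type w))))⟩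
  map F := ObjectProperty.homMk F.hom

/-- The functor `∫!`, where `!` is the unique enriched functor to the one-object
`LexProf`-category of `T` from that of the identity monad, precomposed with the isomorphism
`i ↦ (pt, i)` from `B` to `∫` of the latter. -/
def integBang (T : MonadOn B) : B ⥤ Integ T.toECat :=
  iota (C := (MonadOn.one B).toECat) Pt.pt ⋙ integMap (MonadOn.Hom.toEFunctor T.fromOne)

/-- The category under `B` given by `∫` of the one-object `LexProf`-category of `T`; the object `(pt, i)` is identified
with `i`. -/
def integUnder (T : MonadOn B) : UnderId B where
  Hom i j := (⟨Pt.pt, i⟩ : Integ T.toECat) ⟶ ⟨Pt.pt, j⟩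
  id i := 𝟙 (⟨Pt.pt, i⟩ : Integ T.toECat)
  comp f g := f ≫ g
  id_comp f := Category.id_comp f
  comp_id f := Category.comp_id f
  assoc f g h := Category.assoc f g h
  J φ := (integBang T).map φ
  J_id i := (integBang T).map_id i
  J_comp f g := (integBang T).map_comp f g

/-- The isomorphism of categories `i ↦ (pt, i)`. -/
def integUnderIncl (T : MonadOn B) : (integUnder T).Obj ⥤ Integ T.toECat where
  obj x := ⟨Pt.pt, x.of⟩
  map f := f

/-- `integUnderIncl` is fully faithful. -/
def integUnderInclFF (T : MonadOn B) : (integUnderIncl T).FullyFaithful where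
  preimage f := f

/-- `J` corresponds to `i ↦ (pt, i)`. -/
def integUnderJ (T : MonadOn B) :
    (integUnder T).functor ⋙ integUnderIncl T ≅ iota (C := T.toECat) Pt.pt :=
  NatIso.ofComponents (fun _ => Iso.refl _) (fun f =>
    (Category.comp_id _).trans (Category.id_comp _).symm)

/-- The sieve of `∫T`. -/
def integUnderSieve (T : MonadOn B) : LexSieve.{w} (integUnder T).Obj where
  mem X := (integSieve T.toECat).mem (X ⋙ integUnderIncl T)
  lex {A X} h := by
    have := (integSieve T.toECat).lex h
    have := (integUnderInclFF T).full
    have := (integUnderInclFF T).faithful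
    exact preservesFiniteLimits_of_reflects_of_preserves X (integUnderIncl T)
  precomp G h hG := (integSieve T.toECat).precomp G h hG
  of_iso h e := (integSieve T.toECat).of_iso h (Functor.isoWhiskerRight e _)
  exists_obj c := ⟨B, (integUnder T).functor,
    ⟨B, Pt.pt, 𝟭 _, inferInstance, ⟨integUnderJ T⟩⟩, c.of, rfl⟩

/-- The Lawvere `LexProf`-category of a monad `T` on `B`: the free completion `∫` under absolute
tensors, applied to the unique enriched functor into the one-object `LexProf`-category of `T`. -/
def completionObj (T : MonadOn B) : LawLex B where
  toUnderId := integUnder T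
  sieve := integUnderSieve T
  lex X hX := ⟨B, Pt.pt, X, hX, ⟨Functor.isoWhiskerLeft X (integUnderJ T)⟩⟩
  refl := by
    rintro A Y ⟨_, ⟨⟩, F, hF, ⟨e⟩⟩
    have := (integUnderInclFF T).full
    have := (integUnderInclFF T).faithful
    exact ⟨F, hF, ⟨Functor.fullyFaithfulCancelRight (integUnderIncl T)
      (Functor.isoWhiskerLeft F (integUnderJ T) ≪≫ e.symm)⟩⟩

/-- The functor `T ↦ (∫! : B → ∫T)`. -/
def completion (B : LexCat.{w}) : MonadOn B ⥤ LawLex B where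
  obj T := completionObj T
  map {S T} f :=
    { hom :=
        { map := fun g => (integMap (MonadOn.Hom.toEFunctor f)).map g
          map_id := fun i => (integMap (MonadOn.Hom.toEFunctor f)).map_id ⟨Pt.pt, i⟩
          map_comp := fun g h => (integMap (MonadOn.Hom.toEFunctor f)).map_comp g h
          map_J := fun {i j} φ => congrArg (fun α => Prof.app (M := idProf B) (a := i) (b := j) α φ)
            f.unit_hom }
      lex := by
        rintro A X ⟨_, ⟨⟩, F, hF, ⟨e⟩⟩
        let e' : iota (C := S.toECat) Pt.pt ⋙ integMap (MonadOn.Hom.toEFunctor f) ≅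
            iota (C := T.toECat) Pt.pt :=
          NatIso.ofComponents (fun _ => Iso.refl _) (fun {i j} φ =>
            (Category.comp_id _).trans ((congrArg (fun α =>
              Prof.app (M := idProf B) (a := i) (b := j) α φ) f.unit_hom).trans
                (Category.id_comp ((iota (C := T.toECat) Pt.pt).map φ)).symm))
        exact ⟨B, Pt.pt, F, hF, ⟨Functor.isoWhiskerRight e
          (integMap (MonadOn.Hom.toEFunctor f)) ≪≫ Functor.isoWhiskerLeft F e'⟩⟩ }
  map_id T := rfl
  map_comp f g := rfl

end Theories

section ActMonad

variable {A : LexCat.{w}}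

/-- The monad `X ↦ (c ↦ ∫^b T(b, c) × X b)` on `FL(A, Set)` obtained by applying the homomorphism
of bicategories from `LexProf` to categories to a monad `T` on `A`. -/
def actMonad (T : MonadOn A) : Monad (FL A) where
  toFunctor := act T.hom
  η := (actId A).inv ≫ actMap (N' := T.hom) T.unit
  μ := (actComp T.hom T.hom).hom ≫ actMap (N := compProf T.hom T.hom) (N' := T.hom) T.mul
  assoc X := by
    refine FL.hom_ext fun c t => ?_
    induction t using tens_ind with
    | h b n t =>
      induction t using tens_ind with
      | h b' n' t =>
        induction t using tens_ind with
        | h b'' n'' x =>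
          exact congrArg (fun α => tmk T.hom X.obj (b := b'') (Prof.app
            (M := compProf (compProf T.hom T.hom) T.hom) (N := T.hom) α
              (tmk T.hom (Functor.obj (compProf T.hom T.hom) (op b'')).obj n
                (tmk T.hom (Functor.obj T.hom (op b'')).obj n' n''))) x) T.assoc
  left_unit X := by
    refine FL.hom_ext fun c t => ?_
    induction t using tens_ind with
    | h b n x =>
      refine (congrArg (fun α => tmk T.hom X.obj (b := b) (Prof.app
        (M := compProf T.hom (idProf A)) (N := T.hom) α
          (tmk (idProf A) (Functor.obj T.hom (op b)).obj (c := c) (𝟙 c) n)) x) T.mul_unit).trans ?_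
      exact congrArg (fun z => tmk T.hom X.obj (b := b) z x) (Prof.rmap_id T.hom n)
  right_unit X := by
    refine FL.hom_ext fun c t => ?_
    induction t using tens_ind with
    | h b n x =>
      refine (congrArg (fun α => tmk T.hom X.obj (b := b) (Prof.app
        (M := compProf (idProf A) T.hom) (N := T.hom) α
          (tmk T.hom (Functor.obj (idProf A) (op b)).obj (b := b) n (𝟙 b))) x) T.unit_mul).trans ?_
      exact congrArg (fun z => tmk T.hom X.obj (b := b) z x) (Prof.lmap_id T.hom n)

end ActMonad

section Presentable

/-- A small category `carrier` equivalent to the full subcategory of finitely presentable objects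
of `𝒜`, by a fully faithful functor `ι` to `𝒜`. -/
structure SmallFP (𝒜 : Type u) [Category.{w} 𝒜] where
  carrier : Type w
  [cat : SmallCategory carrier]
  ι : carrier ⥤ 𝒜
  [full : ι.Full]
  [faithful : ι.Faithful]
  essImage_iff (X : 𝒜) : ι.essImage X ↔ IsFinitelyPresentable.{w} X

attribute [instance] SmallFP.cat SmallFP.full SmallFP.faithful

variable {𝒜 : Type u} [Category.{w} 𝒜]

/-- Finitely presentable objects are closed under finite colimits. -/
lemma SmallFP.exists_iso_colimit [IsLocallyFinitelyPresentable.{w} 𝒜] (Af : SmallFP 𝒜)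
    {J : Type} [SmallCategory J] [FinCategory J] (K : J ⥤ Af.carrier) [HasColimit (K ⋙ Af.ι)] :
    Af.ι.essImage (colimit (K ⋙ Af.ι)) := by
  have : Fact Cardinal.aleph0.{w}.IsRegular := Cardinal.fact_isRegular_aleph0
  rw [Af.essImage_iff]
  have (k : J) : IsCardinalPresentable.{w} ((K ⋙ Af.ι).obj k) Cardinal.aleph0 :=
    (Af.essImage_iff _).1 (Af.ι.obj_mem_essImage _)
  refine isCardinalPresentable_of_isColimit _ (colimit.isColimit (K ⋙ Af.ι)) _ ?_
  rw [hasCardinalLT_aleph0_iff]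
  infer_instance

noncomputable def SmallFP.createsColimit [IsLocallyFinitelyPresentable.{w} 𝒜] (Af : SmallFP 𝒜)
    {J : Type} [SmallCategory J] [FinCategory J] (K : J ⥤ Af.carrier) [HasColimit (K ⋙ Af.ι)] :
    CreatesColimit K Af.ι :=
  createsColimitOfFullyFaithfulOfIso (Af.exists_iso_colimit K).witness
    (Af.exists_iso_colimit K).getIso

lemma hasFiniteColimits_lfp (𝒜 : Type u) [Category.{w} 𝒜]
    [IsLocallyFinitelyPresentable.{w} 𝒜] : HasFiniteColimits 𝒜 :=
  hasFiniteColimits_of_hasColimitsOfSize 𝒜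

instance [IsLocallyFinitelyPresentable.{w} 𝒜] (Af : SmallFP 𝒜) :
    HasFiniteColimits Af.carrier where
  out J _ _ := by
    have := hasFiniteColimits_lfp 𝒜
    refine ⟨fun K => ?_⟩
    have := Af.createsColimit K
    exact hasColimit_of_created K Af.ι

instance [IsLocallyFinitelyPresentable.{w} 𝒜] (Af : SmallFP 𝒜) :
    PreservesFiniteColimits Af.ι where
  preservesFiniteColimits J _ _ := by
    have := hasFiniteColimits_lfp 𝒜
    refine ⟨fun {K} => ?_⟩
    have := Af.createsColimit K
    infer_instance

/-- The finitely complete category `𝒜_fᵒᵖ`. -/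
abbrev SmallFP.lex [IsLocallyFinitelyPresentable.{w} 𝒜] (Af : SmallFP 𝒜) : LexCat.{w} where
  carrier := Af.carrierᵒᵖ

variable [IsLocallyFinitelyPresentable.{w} 𝒜] (Af : SmallFP 𝒜)

/-- The functor `X ↦ 𝒜(ι -, X)` from `𝒜` to `FL(𝒜_fᵒᵖ, Set)`. -/
def SmallFP.nerve : 𝒜 ⥤ FL Af.lex where
  obj X := ⟨Af.ι.op ⋙ yoneda.obj X, by
    have : PreservesFiniteLimits Af.ι.op := preservesFiniteLimits_op _
    have : PreservesLimitsOfSize.{0, 0} (yoneda.obj X) := inferInstance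
    have : PreservesFiniteLimits (yoneda.obj X) := inferInstance
    exact comp_preservesFiniteLimits Af.ι.op (yoneda.obj X)⟩
  map f := ObjectProperty.homMk (Functor.whiskerLeft Af.ι.op (yoneda.map f))

/-- The category of finitary monads on `𝒜`. -/
abbrev FinMnd (𝒜 : Type u) [Category.{w} 𝒜] : Type (max u w) :=
  ObjectProperty.FullSubcategory
    (fun S : Monad 𝒜 => PreservesFilteredColimitsOfSize.{w, w} S.toFunctor)

/-- The lex profunctor `(i, j) ↦ 𝒜(j, S i)` on `𝒜_fᵒᵖ`. -/
def SmallFP.restr (S : 𝒜 ⥤ 𝒜) : Prof Af.lex Af.lex :=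
  unopUnop Af.carrier ⋙ Af.ι ⋙ S ⋙ Af.nerve

/-- The canonical map `∫^i 𝒜(j, S i) × 𝒜(i, X) → 𝒜(j, S X)`. -/
def SmallFP.restrAct (S : 𝒜 ⥤ 𝒜) : Af.nerve ⋙ act (Af.restr S) ⟶ S ⋙ Af.nerve where
  app X := ObjectProperty.homMk
    { app := fun c => ↾tlift (fun b (n : Af.ι.obj c.unop ⟶ S.obj (Af.ι.obj b.unop))
          (x : Af.ι.obj b.unop ⟶ X) => n ≫ S.map x) (by
        intro b b' f (n : Af.ι.obj c.unop ⟶ S.obj (Af.ι.obj b'.unop)) (x : Af.ι.obj b.unop ⟶ X)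
        change (n ≫ S.map (Af.ι.map f.unop)) ≫ S.map x = n ≫ S.map (Af.ι.map f.unop ≫ x)
        rw [S.map_comp, Category.assoc])
      naturality := by
        intro c c' g
        refine ConcreteCategory.hom_ext _ _ fun t => ?_
        induction t using tens_ind with
        | h b n x => exact Category.assoc (Af.ι.map g.unop) n (S.map x) }
  naturality X Y φ := by
    refine FL.hom_ext fun c t => ?_
    induction t using tens_ind with
    | h b n x =>
      change Af.ι.obj b.unop ⟶ X at x
      change Af.ι.obj c.unop ⟶ S.obj (Af.ι.obj b.unop) at n
      change n ≫ S.map (x ≫ φ) = (n ≫ S.map x) ≫ S.map φ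
      rw [S.map_comp, Category.assoc]

/-- The unit `f ↦ ι f ≫ η`. -/
def SmallFP.restrUnit (S : Monad 𝒜) : idProf Af.lex ⟶ Af.restr S.toFunctor where
  app a := ObjectProperty.homMk
    { app := fun b => ↾fun f : a.unop ⟶ b => Af.ι.map f.unop ≫ S.η.app (Af.ι.obj a.unop.unop)
      naturality := by
        intro b b' g
        refine ConcreteCategory.hom_ext _ _ fun (f : a.unop ⟶ b) => ?_
        change Af.ι.map (g.unop ≫ f.unop) ≫ _ = Af.ι.map g.unop ≫ Af.ι.map f.unop ≫ _
        rw [Functor.map_comp, Category.assoc] }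
  naturality a a' k := by
    refine FL.hom_ext fun b (f : a.unop ⟶ b) => ?_
    change Af.ι.map (f.unop ≫ k.unop.unop) ≫ S.η.app (Af.ι.obj a'.unop.unop) =
      (Af.ι.map f.unop ≫ S.η.app (Af.ι.obj a.unop.unop)) ≫ S.map (Af.ι.map k.unop.unop)
    rw [Functor.map_comp, Category.assoc, Category.assoc, S.unit_naturality]

/-- The multiplication `[n, m] ↦ n ≫ S m ≫ μ`. -/
def SmallFP.restrMul (S : Monad 𝒜) :
    compProf (Af.restr S.toFunctor) (Af.restr S.toFunctor) ⟶ Af.restr S.toFunctor :=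
  Functor.whiskerLeft (unopUnop Af.carrier ⋙ Af.ι ⋙ S.toFunctor) (Af.restrAct S.toFunctor) ≫
    Functor.whiskerRight (Functor.whiskerLeft (unopUnop Af.carrier ⋙ Af.ι) S.μ) Af.nerve

lemma SmallFP.restrMul_app (S : Monad 𝒜) {i j k : Af.carrier}
    (n : Af.ι.obj k ⟶ S.obj (Af.ι.obj j)) (m : Af.ι.obj j ⟶ S.obj (Af.ι.obj i)) :
    Prof.app (Af.restrMul S) (a := op i) (b := op k)
      (tmk (Af.restr S.toFunctor) ((Af.restr S.toFunctor).obj (op (op i))).obj (b := op j) n m) =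
    (n ≫ S.map m) ≫ S.μ.app (Af.ι.obj i) := rfl

/-- The monad on `𝒜_fᵒᵖ` in `LexProf` corresponding to a finitary monad. -/
def SmallFP.toMonadOnObj (S : Monad 𝒜) : MonadOn Af.lex where
  hom := Af.restr S.toFunctor
  unit := Af.restrUnit S
  mul := Af.restrMul S
  unit_mul := by
    refine Prof.hom_ext fun a c t => ?_
    induction t using tens_ind with
    | h b n f =>
      change a ⟶ b at f
      change Af.ι.obj c.unop ⟶ S.obj (Af.ι.obj b.unop) at n
      change (n ≫ S.map (Af.ι.map f.unop ≫ S.η.app _)) ≫ S.μ.app _ = n ≫ S.map (Af.ι.map f.unop)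
      rw [Functor.map_comp, Category.assoc, Category.assoc, S.right_unit]
      exact congrArg (n ≫ ·) (Category.comp_id (S.map (Af.ι.map f.unop)))
  mul_unit := by
    refine Prof.hom_ext fun a c t => ?_
    induction t using tens_ind with
    | h b f m =>
      change b ⟶ c at f
      change Af.ι.obj b.unop ⟶ S.obj (Af.ι.obj a.unop) at m
      change ((Af.ι.map f.unop ≫ S.η.app _) ≫ S.map m) ≫ S.μ.app _ = Af.ι.map f.unop ≫ m
      rw [Category.assoc, Category.assoc, ← S.unit_naturality_assoc, S.left_unit]
      exact congrArg (Af.ι.map f.unop ≫ ·) (Category.comp_id m)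
  assoc := by
    refine Prof.hom_ext fun a c t => ?_
    induction t using tens_ind with
    | h b n t =>
      induction t using tens_ind with
      | h b' n' m =>
        change Af.ι.obj c.unop ⟶ S.obj (Af.ι.obj b.unop) at n
        change Af.ι.obj b.unop ⟶ S.obj (Af.ι.obj b'.unop) at n'
        change Af.ι.obj b'.unop ⟶ S.obj (Af.ι.obj a.unop) at m
        change (n ≫ S.map ((n' ≫ S.map m) ≫ S.μ.app _)) ≫ S.μ.app _ =
          (((n ≫ S.map n') ≫ S.μ.app _) ≫ S.map m) ≫ S.μ.app _
        simp only [Functor.map_comp, Category.assoc, S.assoc]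
        rw [S.mu_naturality_assoc]

/-- The functor from finitary monads on `𝒜` to monads on `𝒜_fᵒᵖ` in `LexProf`. -/
def SmallFP.toMonadOn : FinMnd 𝒜 ⥤ MonadOn Af.lex where
  obj S := Af.toMonadOnObj S.obj
  map {S S'} θ :=
    { hom := Functor.whiskerLeft (unopUnop Af.carrier ⋙ Af.ι)
        (Functor.whiskerRight θ.hom.toNatTrans Af.nerve)
      unit_hom := by
        refine Prof.hom_ext fun a b (f : a ⟶ b) => ?_
        change (Af.ι.map f.unop ≫ S.obj.η.app _) ≫ θ.hom.app _ = Af.ι.map f.unop ≫ S'.obj.η.app _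
        rw [Category.assoc, θ.hom.app_η]
      mul_hom := by
        refine Prof.hom_ext fun a c t => ?_
        induction t using tens_ind with
        | h b n m =>
          change Af.ι.obj c.unop ⟶ S.obj.obj (Af.ι.obj b.unop) at n
          change Af.ι.obj b.unop ⟶ S.obj.obj (Af.ι.obj a.unop) at m
          change ((n ≫ S.obj.map m) ≫ S.obj.μ.app _) ≫ θ.hom.app _ =
            ((n ≫ θ.hom.app _) ≫ S'.obj.map (m ≫ θ.hom.app _)) ≫ S'.obj.μ.app _
          rw [Category.assoc, θ.hom.app_μ]
          simp }
  map_id S := by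
    refine MonadOn.Hom.ext (Prof.hom_ext fun a b f => ?_)
    change _ ≫ 𝟙 _ = _
    exact Category.comp_id _
  map_comp {S S' S''} f g := by
    refine MonadOn.Hom.ext (Prof.hom_ext fun a b n => ?_)
    change Af.ι.obj b.unop ⟶ S.obj.obj (Af.ι.obj a.unop) at n
    exact (Category.assoc n (f.hom.app _) (g.hom.app _)).symm

/-- The category with objects those of `𝒜_fᵒᵖ`, hom-sets `L_S(i, j) = 𝒜(j, S i)` and Kleisli
composition, together with the identity-on-objects functor given on homs by postcomposition
with the unit. -/
def SmallFP.kleisli (S : Monad 𝒜) : UnderId Af.lex where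
  Hom i j := Af.ι.obj j.unop ⟶ S.obj (Af.ι.obj i.unop)
  id i := S.η.app (Af.ι.obj i.unop)
  comp {i _ _} f g := g ≫ S.map f ≫ S.μ.app (Af.ι.obj i.unop)
  id_comp {i j} f := by
    rw [S.right_unit]
    exact Category.comp_id f
  comp_id {i j} f := by
    rw [← S.unit_naturality_assoc, S.left_unit]
    exact Category.comp_id f
  assoc f g h := by
    simp only [Functor.map_comp, Category.assoc, S.assoc]
    rw [S.mu_naturality_assoc]
  J {i _} f := Af.ι.map f.unop ≫ S.η.app (Af.ι.obj i.unop)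
  J_id i := by
    change Af.ι.map (𝟙 i.unop) ≫ _ = _
    rw [Af.ι.map_id]
    exact Category.id_comp _
  J_comp {i j k} f g := by
    change Af.ι.map (g.unop ≫ f.unop) ≫ _ = _
    simp only [Functor.map_comp, Category.assoc]
    rw [← S.unit_naturality_assoc, ← S.unit_naturality_assoc, S.left_unit]
    exact congrArg (fun z => Af.ι.map g.unop ≫ Af.ι.map f.unop ≫ z) (Category.comp_id _).symm

lemma SmallFP.kleisli_preservesFiniteLimits (S : Monad 𝒜) :
    PreservesFiniteLimits (Af.kleisli S).functor := by
  refine ⟨fun J _ _ => ⟨fun {K} => ⟨fun {c} hc => ⟨coyonedaJointlyReflectsLimits _ _ fun x => ?_⟩⟩⟩⟩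
  let e : (Af.nerve.obj (S.obj (Af.ι.obj x.unop.of.unop))).obj ≅
      (Af.kleisli S).functor ⋙ coyoneda.obj x :=
    NatIso.ofComponents (fun _ => Iso.refl _) (by
      intro i j φ
      refine ConcreteCategory.hom_ext _ _ fun f => ?_
      change Af.ι.obj i.unop ⟶ S.obj (Af.ι.obj x.unop.of.unop) at f
      change Af.ι.map φ.unop ≫ f =
        (Af.ι.map φ.unop ≫ S.η.app _) ≫ S.map f ≫ S.μ.app (Af.ι.obj x.unop.of.unop)
      rw [Category.assoc, ← S.unit_naturality_assoc, S.left_unit]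
      exact congrArg (Af.ι.map φ.unop ≫ ·) (Category.comp_id f).symm)
  have : PreservesFiniteLimits ((Af.kleisli S).functor ⋙ coyoneda.obj x) :=
    preservesFiniteLimits_of_natIso e
  exact isLimitOfPreserves ((Af.kleisli S).functor ⋙ coyoneda.obj x) hc

/-- The Nishizawa–Power functor `S ↦ L_S` from finitary monads on `𝒜` to Lawvere `𝒜`-theories. -/
def SmallFP.nishizawaPower : FinMnd 𝒜 ⥤ Law Af.lex where
  obj S := ⟨Af.kleisli S.obj, Af.kleisli_preservesFiniteLimits S.obj⟩
  map {S S'} θ := ObjectProperty.homMk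
    { map := fun {i _} f => f ≫ θ.hom.app (Af.ι.obj i.unop)
      map_id := fun i => θ.hom.app_η (Af.ι.obj i.unop)
      map_comp := fun {i j k} (f : Af.ι.obj j.unop ⟶ S.obj.obj (Af.ι.obj i.unop))
          (g : Af.ι.obj k.unop ⟶ S.obj.obj (Af.ι.obj j.unop)) => by
        change (g ≫ S.obj.map f ≫ S.obj.μ.app _) ≫ θ.hom.app _ =
          (g ≫ θ.hom.app _) ≫ S'.obj.map (f ≫ θ.hom.app _) ≫ S'.obj.μ.app _
        simp only [Category.assoc, θ.hom.app_μ, Functor.map_comp]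
        simp
      map_J := fun {i j} f => by
        change (Af.ι.map f.unop ≫ S.obj.η.app _) ≫ θ.hom.app _ = Af.ι.map f.unop ≫ S'.obj.η.app _
        rw [Category.assoc, θ.hom.app_η] }
  map_id S := by
    refine ObjectProperty.hom_ext _ (UnderId.Mor.ext ?_)
    funext i j f
    exact Category.comp_id f
  map_comp {S S' S''} θ θ' := by
    refine ObjectProperty.hom_ext _ (UnderId.Mor.ext ?_)
    funext i j f
    exact (Category.assoc f (θ.hom.app _) (θ'.hom.app _)).symm

/-- The data exhibiting a functor `Φ` from finitary monads on `𝒜` to monads on `𝒜_fᵒᵖ` in `LexProf`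
as transport across the biequivalence of locally finitely presentable categories with `LexProf`:
the monad `S` on `𝒜` corresponds along `nerve : 𝒜 ⥤ FL(𝒜_fᵒᵖ, Set)` to the monad on
`FL(𝒜_fᵒᵖ, Set)` given by the action of `Φ S`, naturally in `S`. -/
structure SmallFP.Transport (Φ : FinMnd 𝒜 ⥤ MonadOn Af.lex) where
  iso (S : FinMnd 𝒜) : S.obj.toFunctor ⋙ Af.nerve ≅ Af.nerve ⋙ act (Φ.obj S).hom
  unit (S : FinMnd 𝒜) (X : 𝒜) :
    Af.nerve.map (S.obj.η.app X) ≫ (iso S).hom.app X =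
      (actMonad (Φ.obj S)).η.app (Af.nerve.obj X)
  mul (S : FinMnd 𝒜) (X : 𝒜) :
    Af.nerve.map (S.obj.μ.app X) ≫ (iso S).hom.app X =
      (iso S).hom.app (S.obj.obj X) ≫ (act (Φ.obj S).hom).map ((iso S).hom.app X) ≫
        (actMonad (Φ.obj S)).μ.app (Af.nerve.obj X)
  naturality {S S' : FinMnd 𝒜} (θ : S ⟶ S') (X : 𝒜) :
    Af.nerve.map (θ.hom.app X) ≫ (iso S').hom.app X =
      (iso S).hom.app X ≫ (actMap (MonadOn.Hom.hom (Φ.map θ))).app (Af.nerve.obj X)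

variable {Af} in
/-- Given a transport `Φ` of finitary monads on `𝒜` to monads on `𝒜_fᵒᵖ` in `LexProf`, the functor
from finitary monads on `𝒜` to Lawvere `𝒜`-theories which sends `S` to (the Lawvere theory
underlying) the free completion under absolute tensors of the one-object `LexProf`-category
corresponding to `Φ S`. -/
def SmallFP.viaCompletion (Φ : FinMnd 𝒜 ⥤ MonadOn Af.lex) : FinMnd 𝒜 ⥤ Law Af.lex :=
  Φ ⋙ completion Af.lex ⋙ forgetSieve Af.lex

end Presentable

end LexProf

open LexProf

/-!
The nerve `𝒜 ⥤ FL(𝒜_fᵒᵖ, Set)` is an equivalence because `𝒜_f` is dense in `𝒜`, and because a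
finite-limit-preserving presheaf on `𝒜_f` has a filtered (opposite) category of elements, whose
colimit in `𝒜` is not changed by mapping out of finitely presentable objects.

Everything else rests on two computations with the coend `∫^i T(i, j) × 𝒜(i, X)`.

* For finitary `S`, the canonical map `∫^i 𝒜(j, S i) × 𝒜(i, X) → 𝒜(j, S X)` is bijective
  (`SmallFP.restrAct_bijective`): `X` is the filtered colimit of the finitely presentable objects
  over it, so every map `j ⟶ S X` factors through some `S i`, essentially uniquely. This gives the
  explicit transport, and shows that `S` is determined by its restriction to `𝒜_f`.
* For `X = ι i`, the co-Yoneda lemma identifies the coend with `T(i, j)`. Hence, whenever the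
  action of a monad `T` in `LexProf` corresponds to a monad `S` on `𝒜` along the nerve, there are
  bijections `T(i, j) ≅ 𝒜(j, S i)`, and the compatibility with units and multiplications says
  precisely that they form an isomorphism from `∫T` to the Kleisli theory `L_S`
  (`SmallFP.IsMonadIso.kleisliIso`). For a transport this is natural in `S`, so the functor through
  the completion `∫` is isomorphic to that of Nishizawa and Power; for the explicit transport the
  bijection is `f ↦ f ≫ S (𝟙)`, the identity.

It remains to see that the Nishizawa–Power functor is an equivalence. A morphism of theories
`L_S ⟶ L_S'` is in particular a 2-cell between the lex profunctors `𝒜(j, S i)` and `𝒜(j, S' i)`;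
its action on coends, read through the first computation, is the unique extension to a monad
morphism `S ⟶ S'` (`SmallFP.extend`). Conversely the hom-sets of a theory `L` form a monad in
`LexProf`; its action commutes with filtered colimits, so its conjugate along the nerve is a
finitary monad on `𝒜`, and the second computation shows that its Kleisli theory is `L`.
-/

namespace LexProf


/-! ### Finitely presentable objects generate -/

section Generation

variable {𝒜 : Type u} [Category.{w} 𝒜] (Af : SmallFP 𝒜)

instance SmallFP.isFinitelyPresentable (i : Af.carrier) :
    IsFinitelyPresentable.{w} (Af.ι.obj i) :=
  (Af.essImage_iff _).1 (Af.ι.obj_mem_essImage i)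

/-- The canonical cocone with vertex `S X` on the objects `S (ι i)`, indexed by the maps
`ι i ⟶ X`. -/
abbrev SmallFP.canonicalCocone (S : 𝒜 ⥤ 𝒜) (X : 𝒜) :
    Cocone ((CostructuredArrow.proj Af.ι X ⋙ Af.ι) ⋙ S) :=
  S.mapCocone ((Functor.LeftExtension.mk (𝟭 𝒜) Af.ι.rightUnitor.inv).coconeAt X)

lemma SmallFP.canonicalCocone_ι_app (S : 𝒜 ⥤ 𝒜) (X : 𝒜) (x : CostructuredArrow Af.ι X) :
    (Af.canonicalCocone S X).ι.app x = S.map x.hom :=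
  congrArg S.map (Category.id_comp x.hom)

variable [IsLocallyFinitelyPresentable.{w} 𝒜]

/-- `ι` factors as an equivalence followed by the inclusion of the full subcategory of finitely
presentable objects, which is dense. -/
instance SmallFP.isDense : Af.ι.IsDense := by
  have : Fact Cardinal.aleph0.{w}.IsRegular := Cardinal.fact_isRegular_aleph0
  let P := ObjectProperty.isFinitelyPresentable.{w} 𝒜
  let G : Af.carrier ⥤ P.FullSubcategory := P.lift Af.ι Af.isFinitelyPresentable
  have : G.EssSurj := ⟨fun X => by
    have h := (Af.essImage_iff X.obj).2 X.property
    exact ⟨h.witness, ⟨P.isoMk h.getIso⟩⟩⟩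
  have : G.Faithful := Functor.Faithful.of_comp_iso (P.liftCompιIso Af.ι _)
  have : G.Full := Functor.Full.of_comp_faithful_iso (P.liftCompιIso Af.ι _)
  have : G.IsEquivalence := {}
  have : P.ι.IsDense := inferInstance
  exact inferInstanceAs (G ⋙ P.ι).IsDense

instance SmallFP.isFiltered_costructuredArrow (X : 𝒜) :
    IsFiltered (CostructuredArrow Af.ι X) :=
  (coflat_of_preservesFiniteColimits Af.ι).filtered X

/-- A finitary functor is the left Kan extension of its restriction to the finitely presentable
objects. -/
noncomputable def SmallFP.isColimitCanonicalCocone (S : 𝒜 ⥤ 𝒜)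
    [PreservesFilteredColimitsOfSize.{w, w} S] (X : 𝒜) :
    IsColimit (Af.canonicalCocone S X) :=
  isColimitOfPreserves S (Af.ι.denseAt X)

section

variable (S : 𝒜 ⥤ 𝒜) [PreservesFilteredColimitsOfSize.{w, w} S]

lemma SmallFP.exists_factorization {k : Af.carrier} {X : 𝒜} (g : Af.ι.obj k ⟶ S.obj X) :
    ∃ (i : Af.carrier) (n : Af.ι.obj k ⟶ S.obj (Af.ι.obj i)) (x : Af.ι.obj i ⟶ X),
      n ≫ S.map x = g := by
  obtain ⟨x, n, hn⟩ := IsFinitelyPresentable.exists_hom_of_isColimit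
    (Af.isColimitCanonicalCocone S X) g
  rw [Af.canonicalCocone_ι_app] at hn
  exact ⟨x.left, n, x.hom, hn⟩

/-- Two factorizations of a map `ι k ⟶ S X` become equal at a common finitely presentable stage. -/
lemma SmallFP.exists_common_factorization {k i i' : Af.carrier} {X : 𝒜}
    (n : Af.ι.obj k ⟶ S.obj (Af.ι.obj i)) (x : Af.ι.obj i ⟶ X)
    (n' : Af.ι.obj k ⟶ S.obj (Af.ι.obj i')) (x' : Af.ι.obj i' ⟶ X)
    (h : n ≫ S.map x = n' ≫ S.map x') :
    ∃ (j : Af.carrier) (u : i ⟶ j) (u' : i' ⟶ j) (y : Af.ι.obj j ⟶ X),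
      Af.ι.map u ≫ y = x ∧ Af.ι.map u' ≫ y = x' ∧
        n ≫ S.map (Af.ι.map u) = n' ≫ S.map (Af.ι.map u') := by
  obtain ⟨y, u, u', e⟩ := IsFinitelyPresentable.exists_eq_of_isColimit
    (Af.isColimitCanonicalCocone S X) (i := CostructuredArrow.mk x) (j := CostructuredArrow.mk x')
    n n' (by rw [Af.canonicalCocone_ι_app, Af.canonicalCocone_ι_app]; exact h)
  exact ⟨y.left, u.left, u'.left, y.hom, CostructuredArrow.w u, CostructuredArrow.w u', e⟩

/-- The maps `ι k ⟶ S X` that factor through some `S i` are jointly epimorphic. -/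
lemma SmallFP.hom_ext_of_finitary {X Z : 𝒜} {φ ψ : S.obj X ⟶ Z}
    (h : ∀ (i k : Af.carrier) (n : Af.ι.obj k ⟶ S.obj (Af.ι.obj i)) (x : Af.ι.obj i ⟶ X),
      n ≫ S.map x ≫ φ = n ≫ S.map x ≫ ψ) : φ = ψ := by
  refine (Af.isColimitCanonicalCocone S X).hom_ext fun x => ?_
  rw [Af.canonicalCocone_ι_app]
  refine (Af.isColimitCanonicalCocone (𝟭 𝒜) _).hom_ext fun n => ?_
  rw [Af.canonicalCocone_ι_app]
  exact h x.left n.left n.hom x.hom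

end

lemma SmallFP.hom_ext {Y Z : 𝒜} {φ ψ : Y ⟶ Z}
    (h : ∀ (k : Af.carrier) (n : Af.ι.obj k ⟶ Y), n ≫ φ = n ≫ ψ) : φ = ψ :=
  Af.hom_ext_of_finitary (𝟭 𝒜) fun i _ n x => by
    simpa using congrArg (n ≫ ·) (h i x)

end Generation

/-! ### The nerve is an equivalence -/

section Nerve

variable {𝒜 : Type u} [Category.{w} 𝒜] [IsLocallyFinitelyPresentable.{w} 𝒜] (Af : SmallFP 𝒜)

instance : Af.nerve.Faithful where
  map_injective h := Af.hom_ext fun k n =>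
    ConcreteCategory.congr_hom (NatTrans.congr_app (congrArg (·.hom) h) (op k)) n

/-- A map of nerves `X ⟶ Y` is a cocone with vertex `Y` on the canonical diagram of `X`. -/
instance : Af.nerve.Full where
  map_surjective {X Y} α := by
    let a {k : Af.carrier} (n : Af.ι.obj k ⟶ X) : Af.ι.obj k ⟶ Y := α.hom.app (op k) n
    have ha {k k' : Af.carrier} (f : k ⟶ k') (n : Af.ι.obj k' ⟶ X) :
        a (Af.ι.map f ≫ n) = Af.ι.map f ≫ a n :=
      ConcreteCategory.congr_hom (α.hom.naturality f.op) n
    let c : Cocone ((CostructuredArrow.proj Af.ι X ⋙ Af.ι) ⋙ 𝟭 𝒜) :=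
      { pt := Y
        ι := { app := fun x => a x.hom
               naturality := fun x x' f => by
                have := ha f.left x'.hom
                rw [CostructuredArrow.w f] at this
                exact this.symm.trans (Category.comp_id _).symm } }
    refine ⟨(Af.isColimitCanonicalCocone (𝟭 𝒜) X).desc c, FL.hom_ext fun k n => ?_⟩
    have := (Af.isColimitCanonicalCocone (𝟭 𝒜) X).fac c (CostructuredArrow.mk n)
    rw [Af.canonicalCocone_ι_app] at this
    exact this

/-- A finite-limit-preserving presheaf `X` on `𝒜_f` is the nerve of the colimit in `𝒜` of its
category of elements: this is filtered, so maps from finitely presentable objects into the colimit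
factor, essentially uniquely, through the diagram. -/
instance : Af.nerve.EssSurj where
  mem_essImage X := by
    have : HasFiniteLimits X.obj.Elements := ⟨fun J _ _ => inferInstance⟩
    have : IsCofiltered X.obj.Elements := IsCofiltered.of_hasFiniteLimits _
    let K : X.obj.Elementsᵒᵖ ⥤ 𝒜 := (CategoryOfElements.π X.obj).leftOp ⋙ Af.ι
    have : HasColimitsOfSize.{w, w} 𝒜 := inferInstance
    have hc := colimit.isColimit K
    let e (k : Af.carrier) (x : X.obj.obj (op k)) : X.obj.Elements := ⟨op k, x⟩
    let φ (k : Af.carrier) (x : X.obj.obj (op k)) : Af.ι.obj k ⟶ colimit K :=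
      colimit.ι K (op (e k x))
    have hφ {k k' : Af.carrier} (f : k ⟶ k') (x : X.obj.obj (op k')) :
        φ k (X.obj.map f.op x) = Af.ι.map f ≫ φ k' x :=
      (colimit.w K (CategoryOfElements.homMk (F := X.obj) (e k' x) (e k (X.obj.map f.op x))
        f.op rfl).op).symm
    have hbij (k : Af.carrier) : Function.Bijective (φ k) := by
      constructor
      · intro x x' h
        obtain ⟨y, u, u', h'⟩ := IsFinitelyPresentable.exists_eq_of_isColimit hc
          (X := Af.ι.obj k) (i := op (e k x)) (j := op (e k x')) (𝟙 _) (𝟙 _)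
          ((Category.id_comp _).trans (h.trans (Category.id_comp _).symm))
        have h' : K.map u = K.map u' :=
          (Category.id_comp _).symm.trans (h'.trans (Category.id_comp _))
        have huu : u.unop.1 = u'.unop.1 := Quiver.Hom.unop_inj (Af.ι.map_injective h')
        refine u.unop.2.symm.trans (Eq.trans ?_ u'.unop.2)
        rw [huu]
      · intro g
        obtain ⟨y, p, rfl⟩ := IsFinitelyPresentable.exists_hom_of_isColimit hc g
        obtain ⟨f, rfl⟩ := Af.ι.map_surjective (X := k) (Y := y.unop.1.unop) p
        exact ⟨X.obj.map f.op y.unop.2, hφ f y.unop.2⟩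
    refine ⟨colimit K, ⟨(ObjectProperty.isoMk _ (NatIso.ofComponents
      (fun k => (Equiv.ofBijective _ (hbij k.unop)).toIso) ?_)).symm⟩⟩
    intro k k' f
    refine ConcreteCategory.hom_ext _ _ fun x => ?_
    exact hφ f.unop x

instance SmallFP.nerve_isEquivalence : Af.nerve.IsEquivalence where

end Nerve


/-! ### The restriction of a finitary functor to finitely presentable objects -/

section Restriction

lemma FL.isIso_of_bijective {A : LexCat.{w}} {X Y : FL A} (f : X ⟶ Y)
    (h : ∀ a, Function.Bijective (f.hom.app a)) : IsIso f := by
  have (a : A) : IsIso (f.hom.app a) := (isIso_iff_bijective _).2 (h a)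
  have : IsIso f.hom := NatIso.isIso_of_isIso_app _
  exact (ObjectProperty.isoMk _ (asIso f.hom)).isIso_hom

lemma FL.congr_app {A : LexCat.{w}} {X Y : FL A} {f g : X ⟶ Y} (h : f = g) (a : A)
    (x : X.obj.obj a) : f.hom.app a x = g.hom.app a x := by
  rw [h]

lemma FL.inv_hom_app {A : LexCat.{w}} {X Y : FL A} (e : X ≅ Y) (a : A) (y : Y.obj.obj a) :
    e.hom.hom.app a (e.inv.hom.app a y) = y :=
  FL.congr_app e.inv_hom_id a y

lemma FL.hom_inv_app {A : LexCat.{w}} {X Y : FL A} (e : X ≅ Y) (a : A) (x : X.obj.obj a) :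
    e.inv.hom.app a (e.hom.hom.app a x) = x :=
  FL.congr_app e.hom_inv_id a x

variable {𝒜 : Type u} [Category.{w} 𝒜] [IsLocallyFinitelyPresentable.{w} 𝒜] (Af : SmallFP 𝒜)

/-- The coend `∫^i 𝒜(j, S i) × 𝒜(i, X)` computes `𝒜(j, S X)`: a map `ι j ⟶ S X` factors through
some `S i`, and two factorizations agree at a common stage, so that they have the same class. -/
lemma SmallFP.restrAct_bijective (S : 𝒜 ⥤ 𝒜) [PreservesFilteredColimitsOfSize.{w, w} S] (X : 𝒜)
    (c : Af.lex) : Function.Bijective (((Af.restrAct S).app X).hom.app c) := by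
  constructor
  · intro s s' h
    induction s using tens_ind with
    | h b n x =>
      induction s' using tens_ind with
      | h b' n' x' =>
        change Af.ι.obj b.unop ⟶ X at x
        change Af.ι.obj c.unop ⟶ S.obj (Af.ι.obj b.unop) at n
        change Af.ι.obj b'.unop ⟶ X at x'
        change Af.ι.obj c.unop ⟶ S.obj (Af.ι.obj b'.unop) at n'
        obtain ⟨j, v, v', y, rfl, rfl, e⟩ := Af.exists_common_factorization S n x n' x' h
        refine (tmk_sound (Af.restr S) (Af.nerve.obj X).obj v.op n y).symm.trans
          (Eq.trans ?_ (tmk_sound (Af.restr S) (Af.nerve.obj X).obj v'.op n' y))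
        exact congrArg (fun z => tmk (Af.restr S) (Af.nerve.obj X).obj (b := op j) z y) e
  · intro (g : Af.ι.obj c.unop ⟶ S.obj X)
    obtain ⟨i, n, x, rfl⟩ := Af.exists_factorization S g
    exact ⟨tmk (Af.restr S) (Af.nerve.obj X).obj (b := op i) n x, rfl⟩

/-- For finitary `S`, the canonical map `∫^i 𝒜(j, S i) × 𝒜(i, X) → 𝒜(j, S X)` is invertible. -/
noncomputable def SmallFP.restrActIso (S : 𝒜 ⥤ 𝒜) [PreservesFilteredColimitsOfSize.{w, w} S] :
    Af.nerve ⋙ act (Af.restr S) ≅ S ⋙ Af.nerve :=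
  have (X : 𝒜) : IsIso ((Af.restrAct S).app X) := FL.isIso_of_bijective _ (Af.restrAct_bijective S X)
  have : IsIso (Af.restrAct S) := NatIso.isIso_of_isIso_app _
  asIso (Af.restrAct S)

instance (S : FinMnd 𝒜) : PreservesFilteredColimitsOfSize.{w, w} S.obj.toFunctor := S.property

/-- The transport given by the lex profunctors `(i, j) ↦ 𝒜(j, S i)`. -/
noncomputable def SmallFP.restrTransport : Af.Transport Af.toMonadOn where
  iso S := (Af.restrActIso S.obj.toFunctor).symm
  unit S X := by
    refine (Iso.comp_inv_eq ((Af.restrActIso S.obj.toFunctor).app X)).2 ?_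
    refine FL.hom_ext fun c (f : Af.ι.obj c.unop ⟶ X) => ?_
    change f ≫ S.obj.η.app X = (Af.ι.map (𝟙 c.unop) ≫ S.obj.η.app _) ≫ S.obj.map f
    rw [Af.ι.map_id, Category.id_comp, S.obj.unit_naturality]
  mul S X := by
    refine (Iso.comp_inv_eq ((Af.restrActIso S.obj.toFunctor).app X)).2
      (Eq.trans ?_ (Category.assoc _ _ _).symm)
    refine (Iso.eq_inv_comp ((Af.restrActIso S.obj.toFunctor).app (S.obj.obj X))).2
      (Eq.trans ?_ (Category.assoc _ _ _).symm)
    refine (Iso.eq_inv_comp ((act (Af.restr S.obj.toFunctor)).mapIso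
      ((Af.restrActIso S.obj.toFunctor).app X))).2 ?_
    refine FL.hom_ext fun c s => ?_
    induction s using tens_ind with
    | h b n s =>
      induction s using tens_ind with
      | h b' m x =>
        change Af.ι.obj b'.unop ⟶ X at x
        change Af.ι.obj b.unop ⟶ S.obj.obj (Af.ι.obj b'.unop) at m
        change Af.ι.obj c.unop ⟶ S.obj.obj (Af.ι.obj b.unop) at n
        change (n ≫ S.obj.map (m ≫ S.obj.map x)) ≫ S.obj.μ.app X =
          ((n ≫ S.obj.map m) ≫ S.obj.μ.app _) ≫ S.obj.map x
        simp only [Functor.map_comp, Category.assoc, S.obj.mu_naturality]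
  naturality {S S'} θ X := by
    refine (Iso.comp_inv_eq ((Af.restrActIso S'.obj.toFunctor).app X)).2
      (Eq.trans ?_ (Category.assoc _ _ _).symm)
    refine (Iso.eq_inv_comp ((Af.restrActIso S.obj.toFunctor).app X)).2 ?_
    refine FL.hom_ext fun c s => ?_
    induction s using tens_ind with
    | h b n x =>
      change Af.ι.obj b.unop ⟶ X at x
      change Af.ι.obj c.unop ⟶ S.obj.obj (Af.ι.obj b.unop) at n
      change (n ≫ S.obj.map x) ≫ θ.hom.app X = (n ≫ θ.hom.app _) ≫ S'.obj.map x
      simp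

end Restriction

/-! ### Comparison of the completion with the Kleisli theory -/

section Comparison

/-- A morphism of categories under `B` is invertible as soon as it is bijective on hom-sets. -/
noncomputable def UnderId.isoOfBijective {B : LexCat.{w}} {L M : UnderId B} (F : L ⟶ M)
    (h : ∀ i j : B, Function.Bijective (UnderId.Mor.map F (i := i) (j := j))) : L ≅ M where
  hom := F
  inv :=
    { map := fun {i j} => (Equiv.ofBijective _ (h i j)).symm
      map_id := fun i => (Equiv.symm_apply_eq _).2 (F.map_id i).symm
      map_comp := fun {i j k} f g => (Equiv.symm_apply_eq _).2 (by
        refine Eq.trans ?_ (F.map_comp _ _).symm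
        exact (congrArg₂ M.comp ((Equiv.ofBijective _ (h i j)).apply_symm_apply f)
          ((Equiv.ofBijective _ (h j k)).apply_symm_apply g)).symm)
      map_J := fun f => (Equiv.symm_apply_eq _).2 (F.map_J f).symm }
  hom_inv_id := UnderId.Mor.ext (funext fun i => funext fun j => funext fun f =>
    (Equiv.ofBijective _ (h i j)).symm_apply_apply f)
  inv_hom_id := UnderId.Mor.ext (funext fun i => funext fun j => funext fun f =>
    (Equiv.ofBijective _ (h i j)).apply_symm_apply f)

variable {𝒜 : Type u} [Category.{w} 𝒜] [IsLocallyFinitelyPresentable.{w} 𝒜] (Af : SmallFP 𝒜)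

/-- The co-Yoneda isomorphism `M(i, j) ≅ ∫^b M(b, j) × 𝒜(b, i)`. -/
lemma SmallFP.tmk_id_bijective {B : LexCat.{w}} (M : Prof Af.lex B) (i : Af.carrier) (j : B) :
    Function.Bijective (fun m : M.at (op i) j =>
      tmk M (Af.nerve.obj (Af.ι.obj i)).obj (b := op i) m (𝟙 (Af.ι.obj i))) := by
  refine Function.bijective_iff_has_inverse.2 ⟨tlift (fun b m (x : Af.ι.obj b.unop ⟶ Af.ι.obj i) =>
    M.lmap (a := op i) (a' := b) (Af.ι.preimage x).op m) ?_, fun m => ?_, fun s => ?_⟩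
  · intro b b' f m (x : Af.ι.obj b.unop ⟶ Af.ι.obj i)
    change _ = M.lmap (a := op i) (a' := b') (Af.ι.preimage (Af.ι.map f.unop ≫ x)).op m
    rw [Af.ι.preimage_comp, Af.ι.preimage_map]
    exact (M.lmap_comp (a := op i) (Af.ι.preimage x).op f m).symm
  · change M.lmap (a := op i) (a' := op i) (Af.ι.preimage (𝟙 (Af.ι.obj i))).op m = m
    rw [Af.ι.preimage_id]
    exact M.lmap_id m
  · induction s using tens_ind with
    | h b m x =>
      change Af.ι.obj b.unop ⟶ Af.ι.obj i at x
      refine (tmk_sound M (Af.nerve.obj (Af.ι.obj i)).obj (b := op i) (b' := b)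
        (Af.ι.preimage x).op m (𝟙 (Af.ι.obj i))).trans ?_
      refine congrArg (fun z => tmk M (Af.nerve.obj (Af.ι.obj i)).obj (b := b) m z) ?_
      change Af.ι.map (Af.ι.preimage x) ≫ 𝟙 _ = x
      rw [Af.ι.map_preimage, Category.comp_id]

/-- A monad `S` on `𝒜` corresponds to a monad `T` in `LexProf` along a given isomorphism between
`S` and the action of `T`, if this isomorphism respects units and multiplications. -/
structure SmallFP.IsMonadIso {S : Monad 𝒜} {T : MonadOn Af.lex}
    (e : S.toFunctor ⋙ Af.nerve ≅ Af.nerve ⋙ act T.hom) : Prop where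
  unit (X : 𝒜) : Af.nerve.map (S.η.app X) ≫ e.hom.app X = (actMonad T).η.app (Af.nerve.obj X)
  mul (X : 𝒜) : Af.nerve.map (S.μ.app X) ≫ e.hom.app X =
    e.hom.app (S.obj X) ≫ (act T.hom).map (e.hom.app X) ≫ (actMonad T).μ.app (Af.nerve.obj X)

variable {Af} {S : Monad 𝒜} {T : MonadOn Af.lex}

/-- The map `T(i, j) → 𝒜(j, S i)` which sends `m` to the image of the class `[m, 𝟙]`. -/
def SmallFP.toKleisliHom (e : S.toFunctor ⋙ Af.nerve ≅ Af.nerve ⋙ act T.hom) {i j : Af.lex}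
    (m : T.hom.at i j) : Af.ι.obj j.unop ⟶ S.obj (Af.ι.obj i.unop) :=
  (e.inv.app (Af.ι.obj i.unop)).hom.app j
    (tmk T.hom (Af.nerve.obj (Af.ι.obj i.unop)).obj (b := i) m (𝟙 (Af.ι.obj i.unop)))

lemma SmallFP.hom_toKleisliHom (e : S.toFunctor ⋙ Af.nerve ≅ Af.nerve ⋙ act T.hom) {i j : Af.lex}
    (m : T.hom.at i j) :
    (e.hom.app (Af.ι.obj i.unop)).hom.app j (toKleisliHom e m) =
      tmk T.hom (Af.nerve.obj (Af.ι.obj i.unop)).obj (b := i) m (𝟙 (Af.ι.obj i.unop)) :=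
  FL.inv_hom_app (e.app _) j _

/-- The value of `toKleisliHom` is characterized without the inverse of the isomorphism. -/
lemma SmallFP.eq_toKleisliHom (e : S.toFunctor ⋙ Af.nerve ≅ Af.nerve ⋙ act T.hom) {i j : Af.lex}
    {m : T.hom.at i j} {f : Af.ι.obj j.unop ⟶ S.obj (Af.ι.obj i.unop)}
    (h : (e.hom.app (Af.ι.obj i.unop)).hom.app j f =
      tmk T.hom (Af.nerve.obj (Af.ι.obj i.unop)).obj (b := i) m (𝟙 (Af.ι.obj i.unop))) :
    toKleisliHom e m = f :=
  (congrArg (fun z => (e.inv.app (Af.ι.obj i.unop)).hom.app j z) h.symm).trans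
    (FL.hom_inv_app (e.app _) j f)

lemma SmallFP.toKleisliHom_bijective (e : S.toFunctor ⋙ Af.nerve ≅ Af.nerve ⋙ act T.hom)
    (i j : Af.lex) :
    Function.Bijective (toKleisliHom e (i := i) (j := j)) := by
  refine Function.Bijective.comp (g := fun z => (e.inv.app (Af.ι.obj i.unop)).hom.app j z) ?_
    (Af.tmk_id_bijective T.hom i.unop j)
  exact Function.bijective_iff_has_inverse.2
    ⟨fun z => (e.hom.app (Af.ι.obj i.unop)).hom.app j z, FL.inv_hom_app (e.app _) j,
      FL.hom_inv_app (e.app _) j⟩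

/-- Compatibility with units: `toKleisliHom` commutes with the functors `J`. -/
lemma SmallFP.IsMonadIso.toKleisliHom_unit
    {e : S.toFunctor ⋙ Af.nerve ≅ Af.nerve ⋙ act T.hom} (he : Af.IsMonadIso e) {i j : Af.lex}
    (φ : i ⟶ j) :
    toKleisliHom e (Prof.app (M := idProf Af.lex) (a := i) (b := j) T.unit φ) =
      Af.ι.map φ.unop ≫ S.η.app (Af.ι.obj i.unop) := by
  refine eq_toKleisliHom e ?_
  let X := Af.nerve.obj (Af.ι.obj i.unop)
  let u : T.hom.at j j := Prof.app (M := idProf Af.lex) (a := j) (b := j) T.unit (𝟙 j)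
  -- in the coend `[u, φ] = [u φ, 𝟙]`, and `u φ` is the value of the unit of `T` at `φ`
  have h := Prof.app_lmap (M := idProf Af.lex) T.unit (a := i) (a' := j) φ (b := j) (𝟙 j)
  have h₁ : tmk T.hom X.obj (b := j) u (Af.ι.map φ.unop) =
      tmk T.hom X.obj (b := j) u (X.obj.map φ (𝟙 (Af.ι.obj i.unop))) :=
    congrArg (fun z => tmk T.hom X.obj (b := j) u z) (Category.comp_id (Af.ι.map φ.unop)).symm
  have h₂ := congrArg (fun z => tmk T.hom X.obj (b := i) z (𝟙 (Af.ι.obj i.unop)))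
    (h.symm.trans (congrArg (fun z => Prof.app (M := idProf Af.lex) (a := i) (b := j) T.unit z)
      (Category.comp_id φ)))
  exact (FL.congr_app (he.unit (Af.ι.obj i.unop)) j (Af.ι.map φ.unop)).trans
    (h₁.trans ((tmk_sound T.hom X.obj φ u (𝟙 (Af.ι.obj i.unop))).symm.trans h₂))

/-- Compatibility with multiplications: `toKleisliHom` takes the composition of `∫T` to Kleisli
composition. Under the isomorphism `e`, the map `n ≫ S m` becomes `[n, m]`, which the multiplication
axiom rewrites as the image of `[n, [m, 𝟙]]` under the multiplication of the action. -/
lemma SmallFP.IsMonadIso.toKleisliHom_mul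
    {e : S.toFunctor ⋙ Af.nerve ≅ Af.nerve ⋙ act T.hom} (he : Af.IsMonadIso e) {i j k : Af.lex}
    (m : T.hom.at i j) (n : T.hom.at j k) :
    toKleisliHom e (Prof.app (M := compProf T.hom T.hom) (a := i) (b := k) T.mul
      (tmk T.hom (T.hom.obj (op i)).obj n m)) =
      toKleisliHom e n ≫ S.map (toKleisliHom e m) ≫ S.μ.app (Af.ι.obj i.unop) := by
  refine eq_toKleisliHom e ?_
  rw [← Category.assoc]
  let X := Af.nerve.obj (Af.ι.obj i.unop)
  let Y := Af.nerve.obj (S.obj (Af.ι.obj i.unop))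
  let g : Af.ι.obj k.unop ⟶ S.obj (S.obj (Af.ι.obj i.unop)) :=
    toKleisliHom e n ≫ S.map (toKleisliHom e m)
  have hg : (e.hom.app (S.obj (Af.ι.obj i.unop))).hom.app k g =
      tmk T.hom Y.obj (b := j) n (toKleisliHom e m) :=
    (FL.congr_app (e.hom.naturality (toKleisliHom e m)) k (toKleisliHom e n)).trans
      ((congrArg (fun z => ((act T.hom).map (Af.nerve.map (toKleisliHom e m))).hom.app k z)
        (hom_toKleisliHom e n)).trans
      (congrArg (fun z => tmk T.hom Y.obj (b := j) n z) (Category.id_comp (toKleisliHom e m))))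
  exact (FL.congr_app (he.mul (Af.ι.obj i.unop)) k g).trans
    ((congrArg (fun z => ((actMonad T).μ.app X).hom.app k
      (((act T.hom).map (e.hom.app (Af.ι.obj i.unop))).hom.app k z)) hg).trans
    (congrArg (fun z => ((actMonad T).μ.app X).hom.app k
      (tmk T.hom (tens T.hom X.obj) (b := j) n z)) (hom_toKleisliHom e m)))

/-- The comparison of theories `∫T → L_S`. -/
def SmallFP.IsMonadIso.toKleisli {e : S.toFunctor ⋙ Af.nerve ≅ Af.nerve ⋙ act T.hom}
    (he : Af.IsMonadIso e) : integUnder T ⟶ Af.kleisli S where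
  map f := toKleisliHom e f
  map_id i := (he.toKleisliHom_unit (𝟙 i)).trans ((Af.kleisli S).J_id i)
  map_comp f g := he.toKleisliHom_mul f g
  map_J φ := by
    refine Eq.trans ?_ (he.toKleisliHom_unit φ)
    rfl

/-- If `S` and `T` correspond to each other, then so do their theories. -/
noncomputable def SmallFP.IsMonadIso.kleisliIso
    {e : S.toFunctor ⋙ Af.nerve ≅ Af.nerve ⋙ act T.hom}
    (he : Af.IsMonadIso e) : integUnder T ≅ Af.kleisli S :=
  UnderId.isoOfBijective he.toKleisli (SmallFP.toKleisliHom_bijective e)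

lemma SmallFP.Transport.isMonadIso {Φ : FinMnd 𝒜 ⥤ MonadOn Af.lex} (τ : Af.Transport Φ)
    (S : FinMnd 𝒜) : Af.IsMonadIso (τ.iso S) :=
  ⟨τ.unit S, τ.mul S⟩

/-- The theories obtained from a transport by completion are those of Nishizawa and Power. -/
noncomputable def SmallFP.Transport.viaCompletionIso {Φ : FinMnd 𝒜 ⥤ MonadOn Af.lex}
    (τ : Af.Transport Φ) : SmallFP.viaCompletion Φ ≅ Af.nishizawaPower :=
  NatIso.ofComponents (fun S => ObjectProperty.isoMk _ (τ.isMonadIso S).kleisliIso) (by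
    intro S S' θ
    refine ObjectProperty.hom_ext _ (UnderId.Mor.ext ?_)
    funext i j m
    change (Φ.obj S).hom.at i j at m
    change SmallFP.toKleisliHom (τ.iso S') (Prof.app (MonadOn.Hom.hom (Φ.map θ)) m) =
      SmallFP.toKleisliHom (τ.iso S) m ≫ θ.hom.app (Af.ι.obj i.unop)
    refine SmallFP.eq_toKleisliHom _ ?_
    refine (FL.congr_app (τ.naturality θ (Af.ι.obj i.unop)) j
      (SmallFP.toKleisliHom (τ.iso S) m)).trans ?_
    exact congrArg (fun z => ((actMap (MonadOn.Hom.hom (Φ.map θ))).app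
      (Af.nerve.obj (Af.ι.obj i.unop))).hom.app j z) (SmallFP.hom_toKleisliHom (τ.iso S) m))

/-- The inverse of the explicit transport is `restrAct`, which sends `[f, 𝟙]` to `f ≫ S (𝟙)`. -/
lemma SmallFP.restrTransport_viaCompletionIso (S : FinMnd 𝒜) (i j : Af.carrier)
    (f : Af.ι.obj j ⟶ S.obj.obj (Af.ι.obj i)) :
    UnderId.Mor.map (Af.restrTransport.viaCompletionIso.hom.app S).hom (i := op i) (j := op j) f
      = f := by
  change f ≫ S.obj.map (𝟙 (Af.ι.obj i)) = f
  simp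

end Comparison


/-! ### Morphisms of theories extend to morphisms of monads -/

section FullyFaithful

variable {𝒜 : Type u} [Category.{w} 𝒜] [IsLocallyFinitelyPresentable.{w} 𝒜] (Af : SmallFP 𝒜)

lemma SmallFP.kleisli_comp_J (S : Monad 𝒜) {i j k : Af.lex} (n : (Af.kleisli S).Hom i j)
    (g : j ⟶ k) : (Af.kleisli S).comp n ((Af.kleisli S).J g) = Af.ι.map g.unop ≫ n := by
  change Af.ι.obj j.unop ⟶ S.obj (Af.ι.obj i.unop) at n
  change (Af.ι.map g.unop ≫ S.η.app _) ≫ S.map n ≫ S.μ.app _ = _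
  rw [Category.assoc, ← S.unit_naturality_assoc, S.left_unit]
  exact congrArg (Af.ι.map g.unop ≫ ·) (Category.comp_id n)

lemma SmallFP.kleisli_J_comp (S : Monad 𝒜) {i j k : Af.lex} (f : i ⟶ j)
    (n : (Af.kleisli S).Hom j k) :
    (Af.kleisli S).comp ((Af.kleisli S).J f) n = n ≫ S.map (Af.ι.map f.unop) := by
  change Af.ι.obj k.unop ⟶ S.obj (Af.ι.obj j.unop) at n
  change n ≫ S.map (Af.ι.map f.unop ≫ S.η.app _) ≫ S.μ.app _ = _
  rw [Functor.map_comp, Category.assoc, S.right_unit]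
  exact congrArg (n ≫ ·) (Category.comp_id _)

/-- A morphism out of a finitary monad is determined by its components at the finitely presentable
objects, and these by postcomposition on the hom-sets `𝒜(j, S i)`. -/
instance : Af.nishizawaPower.Faithful where
  map_injective {S S'} θ θ' h := by
    refine ObjectProperty.hom_ext _ (MonadHom.ext (funext fun X =>
      Af.hom_ext_of_finitary S.obj.toFunctor fun i k n x => ?_))
    have e : n ≫ θ.hom.app (Af.ι.obj i) = n ≫ θ'.hom.app (Af.ι.obj i) :=
      congrArg (fun F : Af.nishizawaPower.obj S ⟶ Af.nishizawaPower.obj S' =>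
        UnderId.Mor.map F.hom (i := op i) (j := op k) n) h
    rw [θ.hom.naturality, θ'.hom.naturality, reassoc_of% e]

section

variable {Af} {S S' : Monad 𝒜} (F : Af.kleisli S ⟶ Af.kleisli S')

/-- The action of a morphism of theories on the hom-set `𝒜(j, S i)`. -/
def SmallFP.homMap {i j : Af.carrier} (n : Af.ι.obj j ⟶ S.obj (Af.ι.obj i)) :
    Af.ι.obj j ⟶ S'.obj (Af.ι.obj i) :=
  UnderId.Mor.map F (i := op i) (j := op j) n

lemma SmallFP.homMap_unit (i : Af.carrier) :
    homMap F (S.η.app (Af.ι.obj i)) = S'.η.app (Af.ι.obj i) :=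
  UnderId.Mor.map_id F (op i)

lemma SmallFP.homMap_mul {i j k : Af.carrier} (m : Af.ι.obj j ⟶ S.obj (Af.ι.obj i))
    (n : Af.ι.obj k ⟶ S.obj (Af.ι.obj j)) :
    homMap F (n ≫ S.map m ≫ S.μ.app (Af.ι.obj i)) =
      homMap F n ≫ S'.map (homMap F m) ≫ S'.μ.app (Af.ι.obj i) :=
  UnderId.Mor.map_comp F (i := op i) (j := op j) (k := op k) m n

lemma SmallFP.homMap_precomp {i j k : Af.carrier} (f : k ⟶ j)
    (n : Af.ι.obj j ⟶ S.obj (Af.ι.obj i)) :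
    homMap F (Af.ι.map f ≫ n) = Af.ι.map f ≫ homMap F n :=
  (congrArg (UnderId.Mor.map F) (Af.kleisli_comp_J S (i := op i) (j := op j) n f.op).symm).trans
    ((UnderId.Mor.map_comp F (i := op i) (j := op j) n _).trans
      ((congrArg ((Af.kleisli S').comp (homMap F n)) (UnderId.Mor.map_J F f.op)).trans
        (Af.kleisli_comp_J S' (i := op i) (homMap F n) f.op)))

lemma SmallFP.homMap_postcomp {i j k : Af.carrier} (f : j ⟶ i)
    (n : Af.ι.obj k ⟶ S.obj (Af.ι.obj j)) :
    homMap F (n ≫ S.map (Af.ι.map f)) = homMap F n ≫ S'.map (Af.ι.map f) :=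
  (congrArg (UnderId.Mor.map F) (Af.kleisli_J_comp S f.op (k := op k) n).symm).trans
    ((UnderId.Mor.map_comp F (j := op j) (k := op k) _ n).trans
      ((congrArg (fun z => (Af.kleisli S').comp (k := op k) z (homMap F n))
        (UnderId.Mor.map_J F f.op)).trans
          (Af.kleisli_J_comp S' f.op (k := op k) (homMap F n))))

/-- The 2-cell of lex profunctors given by the action of a morphism of theories on hom-sets. -/
def SmallFP.restrMap : Af.restr S.toFunctor ⟶ Af.restr S'.toFunctor where
  app a := ObjectProperty.homMk
    { app := fun b => ↾fun n : Af.ι.obj b.unop ⟶ S.obj (Af.ι.obj a.unop.unop) => homMap F n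
      naturality := fun _ _ g => ConcreteCategory.hom_ext _ _ fun n => homMap_precomp F g.unop n }
  naturality _ _ k := FL.hom_ext fun _ n => homMap_postcomp F k.unop.unop n

variable [PreservesFilteredColimitsOfSize.{w, w} S.toFunctor]

/-- The transformation of actions induced by a morphism of theories, transferred along the nerve
and evaluated at `X`. -/
noncomputable def SmallFP.extendApp (X : 𝒜) : S.obj X ⟶ S'.obj X :=
  Af.nerve.preimage ((Af.restrActIso S.toFunctor).inv.app X ≫
    (actMap (restrMap F)).app (Af.nerve.obj X) ≫ (Af.restrAct S'.toFunctor).app X)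

/-- The component at `X` is characterized by its effect on the maps `ι k ⟶ S X` that factor through
some `S i`, which are all of them. -/
lemma SmallFP.comp_extendApp {i k : Af.carrier} {X : 𝒜} (n : Af.ι.obj k ⟶ S.obj (Af.ι.obj i))
    (x : Af.ι.obj i ⟶ X) :
    n ≫ S.map x ≫ extendApp F X = homMap F n ≫ S'.map x := by
  let s := tmk (Af.restr S.toFunctor) (Af.nerve.obj X).obj (c := op k) (b := op i) n x
  have h := FL.congr_app (Af.nerve.map_preimage ((Af.restrActIso S.toFunctor).inv.app X ≫
    (actMap (restrMap F)).app (Af.nerve.obj X) ≫ (Af.restrAct S'.toFunctor).app X)) (op k)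
      (n ≫ S.map x)
  refine (Category.assoc n _ _).symm.trans (h.trans ?_)
  exact congrArg (fun z => ((actMap (restrMap F)).app (Af.nerve.obj X) ≫
    (Af.restrAct S'.toFunctor).app X).hom.app (op k) z)
    (FL.hom_inv_app ((Af.restrActIso S.toFunctor).app X) (op k) s)

/-- The morphism of monads whose components at the finitely presentable objects induce a given
morphism of theories. -/
noncomputable def SmallFP.extend : S ⟶ S' where
  app X := extendApp F X
  naturality X Y f := Af.hom_ext_of_finitary S.toFunctor fun i k n x => by
    rw [← S.map_comp_assoc, comp_extendApp, reassoc_of% (comp_extendApp F n x), S'.map_comp]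
  app_η X := Af.hom_ext fun k x => by
    change Af.ι.obj k ⟶ X at x
    have h : x ≫ S.η.app X = S.η.app (Af.ι.obj k) ≫ S.map x := S.η.naturality x
    rw [reassoc_of% h, comp_extendApp, homMap_unit]
    exact (S'.η.naturality x).symm
  app_μ X := Af.hom_ext_of_finitary S.toFunctor fun i k n y => by
    -- on maps of the form `n ≫ S (m ≫ S x)`, the claim is compatibility with Kleisli composites
    obtain ⟨j, m, x, rfl⟩ := Af.exists_factorization S.toFunctor y
    have h := comp_extendApp F (n ≫ S.map m ≫ S.μ.app (Af.ι.obj j)) x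
    rw [homMap_mul] at h
    simp only [Functor.map_comp, Category.assoc] at h ⊢
    rw [S.mu_naturality_assoc]
    refine h.trans ?_
    rw [← S.map_comp_assoc, ← S.map_comp_assoc, Category.assoc, comp_extendApp,
      reassoc_of% (comp_extendApp F n), S'.map_comp, Category.assoc, S'.mu_naturality]

end

instance : Af.nishizawaPower.Full where
  map_surjective {S S'} F := by
    refine ⟨ObjectProperty.homMk (SmallFP.extend F.hom), ObjectProperty.hom_ext _
      (UnderId.Mor.ext ?_)⟩
    funext i j n
    have h := SmallFP.comp_extendApp F.hom (S := S.obj) (S' := S'.obj)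
      (i := i.unop) (k := j.unop) n (𝟙 _)
    rw [S.obj.map_id, S'.obj.map_id, Category.id_comp] at h
    exact h.trans (Category.comp_id _)

end FullyFaithful

/-! ### Lawvere theories as monads in `LexProf` -/

section TheoryMonad

variable {B : LexCat.{w}} (L : Law B)

instance : PreservesFiniteLimits L.obj.functor := L.property

/-- The hom-sets of a Lawvere theory, as a lex profunctor. -/
def Law.prof : Prof B B where
  obj a := ⟨L.obj.functor ⋙ coyoneda.obj (op ⟨a.unop⟩), comp_preservesFiniteLimits _ _⟩
  map f := ObjectProperty.homMk
    (Functor.whiskerLeft _ (coyoneda.map (L.obj.functor.map f.unop).op))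
  map_id a := FL.hom_ext fun b m => by
    change L.obj.comp (L.obj.J (𝟙 a.unop)) m = m
    rw [L.obj.J_id, L.obj.id_comp]
  map_comp {a a' a''} f g := FL.hom_ext fun b m => by
    change L.obj.comp (L.obj.J (g.unop ≫ f.unop)) m =
      L.obj.comp (L.obj.J g.unop) (L.obj.comp (L.obj.J f.unop) m)
    rw [L.obj.J_comp, L.obj.assoc]

/-- A Lawvere theory as a monad in `LexProf`: the unit is given by `J` and the multiplication by
the composition of the theory. -/
def Law.toMonadOn : MonadOn B where
  hom := L.prof
  unit :=
    { app := fun a => ObjectProperty.homMk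
        { app := fun b => ↾fun f : a.unop ⟶ b => L.obj.J f
          naturality := fun b b' g => ConcreteCategory.hom_ext _ _ fun f => L.obj.J_comp f g }
      naturality := fun a a' k => FL.hom_ext fun b f => L.obj.J_comp k.unop f }
  mul :=
    { app := fun a => ObjectProperty.homMk
        { app := fun c => ↾tlift (fun b (n : L.obj.Hom b c) (m : L.obj.Hom a.unop b) =>
            L.obj.comp m n) (fun b b' f n m => (L.obj.assoc m (L.obj.J f) n).symm)
          naturality := by
            intro c c' g
            refine ConcreteCategory.hom_ext _ _ fun s => ?_
            induction s using tens_ind with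
            | h b n m => exact (L.obj.assoc m n (L.obj.J g)).symm }
      naturality := by
        intro a a' k
        refine FL.hom_ext fun c s => ?_
        induction s using tens_ind with
        | h b n m => exact L.obj.assoc (L.obj.J k.unop) m n }
  unit_mul := by
    refine Prof.hom_ext fun a c s => ?_
    induction s using tens_ind with
    | h b n f => rfl
  mul_unit := by
    refine Prof.hom_ext fun a c s => ?_
    induction s using tens_ind with
    | h b f m => rfl
  assoc := by
    refine Prof.hom_ext fun a c s => ?_
    induction s using tens_ind with
    | h b n s =>
      induction s using tens_ind with
      | h b' n' m => exact L.obj.assoc m n' n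

/-- A theory is recovered as the completion of the corresponding monad. -/
noncomputable def Law.integUnderIso : integUnder L.toMonadOn ≅ L.obj :=
  UnderId.isoOfBijective
    { map := fun f => f
      map_id := fun i => L.obj.J_id i
      map_comp := fun _ _ => rfl
      map_J := fun _ => rfl } (fun _ _ => Function.bijective_id)

end TheoryMonad

/-! ### Conjugation of a monad by an equivalence -/

section Conjugate

universe v₁ v₂ u₁ u₂

variable {C : Type u₁} [Category.{v₁} C] {D : Type u₂} [Category.{v₂} D] (E : C ≌ D) (M : Monad D)

/-- The monad on `C` corresponding to a monad on `D` along an equivalence. -/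
def conjMonad : Monad C := (E.toAdjunction.comp M.adj).toMonad

/-- The defining isomorphism of the functor underlying `conjMonad`. -/
def conjMonadIso : (conjMonad E M).toFunctor ⋙ E.functor ≅ E.functor ⋙ M.toFunctor :=
  Functor.isoWhiskerLeft (E.functor ⋙ M.toFunctor) E.counitIso

lemma conjMonad_unit (X : C) :
    E.functor.map ((conjMonad E M).η.app X) ≫ (conjMonadIso E M).hom.app X =
      M.η.app (E.functor.obj X) := by
  have h : (conjMonad E M).η.app X = E.unit.app X ≫ E.inverse.map (M.η.app (E.functor.obj X)) := by
    simp [conjMonad]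
    rfl
  rw [h]
  refine (congrArg (· ≫ _) (E.functor.map_comp _ _)).trans ((Category.assoc _ _ _).trans ?_)
  exact (congrArg (E.functor.map (E.unit.app X) ≫ ·)
    (E.counit.naturality (M.η.app (E.functor.obj X)))).trans
      (E.functor_unit_comp_assoc X (M.η.app (E.functor.obj X)))

lemma conjMonad_mul (X : C) :
    E.functor.map ((conjMonad E M).μ.app X) ≫ (conjMonadIso E M).hom.app X =
      (conjMonadIso E M).hom.app ((conjMonad E M).obj X) ≫
        M.map ((conjMonadIso E M).hom.app X) ≫ M.μ.app (E.functor.obj X) := by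
  have h : (conjMonad E M).μ.app X = E.inverse.map
      (M.map (E.counit.app (M.obj (E.functor.obj X))) ≫ M.μ.app (E.functor.obj X)) := by
    refine (congrArg (fun g => E.inverse.map (Monad.Algebra.Hom.f g))
      (Adjunction.comp_counit_app E.toAdjunction M.adj (M.free.obj (E.functor.obj X)))).trans ?_
    rw [Monad.adj_counit]
    rfl
  rw [h]
  exact E.counit.naturality (M.map (E.counit.app (M.obj (E.functor.obj X))) ≫
    M.μ.app (E.functor.obj X))

end Conjugate

/-! ### Colimits and the action of a profunctor -/

section Colimits

universe v₁ u₁ v₂ u₂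

/-- The coend defining the action of a profunctor commutes with pointwise colimits. -/
lemma act_preservesColimitsOfShape {B D : LexCat.{w}} (N : Prof B D) {C : Type u₁}
    [Category.{v₁} C] (G : C ⥤ FL B) (J : Type u₂) [Category.{v₂} J]
    [∀ b : B, PreservesColimitsOfShape J
      (G ⋙ ObjectProperty.ι _ ⋙ (evaluation B (Type w)).obj b)] :
    PreservesColimitsOfShape J (G ⋙ act N) := by
  have : PreservesColimitsOfShape J ((G ⋙ act N) ⋙ ObjectProperty.ι _) := by
    refine preservesColimitsOfShape_of_evaluation _ _ fun d => ⟨fun {K} => ⟨fun {c} hc => ⟨?_⟩⟩⟩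
    -- a map out of the coend is a dinatural family of maps out of the sets `N(b, d) × colim_j G_j b`,
    -- and the latter are obtained, for fixed `n : N(b, d)`, from the colimit in the second factor
    have hb (b : B) := isColimitOfPreserves
      (G ⋙ ObjectProperty.ι _ ⋙ (evaluation B (Type w)).obj b) hc
    let T : C ⥤ Type w := ((G ⋙ act N) ⋙ ObjectProperty.ι _) ⋙ (evaluation D (Type w)).obj d
    let leg (s : Cocone (K ⋙ T)) (j : J) :
        TensObj N (G.obj (K.obj j)).obj d → s.pt := s.ι.app j
    have hleg (s : Cocone (K ⋙ T)) {j j' : J} (k : j ⟶ j') {b : B} (n : N.at b d)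
        (x : (G.obj (K.obj j)).obj.obj b) :
        leg s j' (tmk N _ n ((G.map (K.map k)).hom.app b x)) = leg s j (tmk N _ n x) :=
      ConcreteCategory.congr_hom (s.w k) (tmk N (G.obj (K.obj j)).obj n x)
    let cc (s : Cocone (K ⋙ T)) (b : B) (n : N.at b d) :
        Cocone (K ⋙ G ⋙ ObjectProperty.ι _ ⋙ (evaluation B (Type w)).obj b) :=
      { pt := s.pt
        ι := { app := fun j => (↾fun x => leg s j (tmk N _ n x) : (G.obj (K.obj j)).obj.obj b ⟶ s.pt)
               naturality := fun j j' k => ConcreteCategory.hom_ext _ _ fun x => hleg s k n x } }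
    let φ (s : Cocone (K ⋙ T)) (b : B) (n : N.at b d) (x : (G.obj c.pt).obj.obj b) : s.pt :=
      (hb b).desc (cc s b n) x
    have hφ (s : Cocone (K ⋙ T)) (b : B) (n : N.at b d) (j : J) (x : (G.obj (K.obj j)).obj.obj b) :
        φ s b n ((G.map (c.ι.app j)).hom.app b x) = leg s j (tmk N _ n x) :=
      ConcreteCategory.congr_hom ((hb b).fac (cc s b n) j) x
    have hsurj (b : B) (x : (G.obj c.pt).obj.obj b) :
        ∃ (j : J) (y : (G.obj (K.obj j)).obj.obj b), (G.map (c.ι.app j)).hom.app b y = x :=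
      Types.jointly_surjective_of_isColimit (hb b) x
    refine
      { desc := fun s => ↾tlift (φ s) ?_
        fac := fun s j => ConcreteCategory.hom_ext _ _ fun t => ?_
        uniq := fun s m hm => ConcreteCategory.hom_ext _ _ fun t => ?_ }
    · intro b b' f n x
      obtain ⟨j, y, rfl⟩ := hsurj b x
      have h : (G.obj c.pt).obj.map f ((G.map (c.ι.app j)).hom.app b y) =
          (G.map (c.ι.app j)).hom.app b' ((G.obj (K.obj j)).obj.map f y) :=
        (ConcreteCategory.congr_hom ((G.map (c.ι.app j)).hom.naturality f) y).symm
      rw [h, hφ, hφ, tmk_sound]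
    · induction t using tens_ind with
      | h b n x => exact hφ s b n j x
    · induction t using tens_ind with
      | h b n x =>
        obtain ⟨j, y, rfl⟩ := hsurj b x
        exact (ConcreteCategory.congr_hom (hm j) (tmk N (G.obj (K.obj j)).obj n y)).trans
          (hφ s b n j y).symm
  exact preservesColimitsOfShape_of_reflects_of_preserves (G ⋙ act N) (ObjectProperty.ι _)

end Colimits

/-! ### Every Lawvere theory comes from a finitary monad -/

section EssSurj

variable {𝒜 : Type u} [Category.{w} 𝒜] [IsLocallyFinitelyPresentable.{w} 𝒜] (Af : SmallFP 𝒜)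

/-- The nerve takes filtered colimits to pointwise colimits, since its values at the objects of
`𝒜_f` are represented by finitely presentable objects. -/
lemma SmallFP.nerve_act_preservesFilteredColimits (N : Prof Af.lex Af.lex) :
    PreservesFilteredColimitsOfSize.{w, w} (Af.nerve ⋙ act N) where
  preserves_filtered_colimits J _ _ := by
    have (b : Af.lex) : PreservesColimitsOfShape J
        (Af.nerve ⋙ ObjectProperty.ι _ ⋙ (evaluation Af.lex (Type w)).obj b) :=
      inferInstanceAs (PreservesColimitsOfShape J (coyoneda.obj (op (Af.ι.obj b.unop))))
    exact act_preservesColimitsOfShape N Af.nerve J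

/-- The finitary monad on `𝒜` corresponding to a monad on `𝒜_fᵒᵖ` in `LexProf`. -/
noncomputable def SmallFP.toFinMnd (T : MonadOn Af.lex) : FinMnd 𝒜 :=
  ⟨conjMonad Af.nerve.asEquivalence (actMonad T), by
    have := Af.nerve_act_preservesFilteredColimits T.hom
    have : PreservesFilteredColimitsOfSize.{w, w} Af.nerve.asEquivalence.inverse :=
      ⟨fun J _ _ => inferInstance⟩
    exact ⟨fun J _ _ => inferInstanceAs (PreservesColimitsOfShape J
      ((Af.nerve ⋙ act T.hom) ⋙ Af.nerve.asEquivalence.inverse))⟩⟩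

lemma SmallFP.toFinMnd_isMonadIso (T : MonadOn Af.lex) :
    Af.IsMonadIso (S := (Af.toFinMnd T).obj) (T := T)
      (conjMonadIso Af.nerve.asEquivalence (actMonad T)) where
  unit X := conjMonad_unit Af.nerve.asEquivalence (actMonad T) X
  mul X := conjMonad_mul Af.nerve.asEquivalence (actMonad T) X

instance : Af.nishizawaPower.EssSurj where
  mem_essImage L := ⟨Af.toFinMnd L.toMonadOn, ⟨ObjectProperty.isoMk _
    ((Af.toFinMnd_isMonadIso L.toMonadOn).kleisliIso.symm ≪≫ L.integUnderIso)⟩⟩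

instance SmallFP.nishizawaPower_isEquivalence : Af.nishizawaPower.IsEquivalence where

end EssSurj

end LexProf


theorem mainTheorem11 {𝒜 : Type u} [Category.{w} 𝒜] [IsLocallyFinitelyPresentable.{w} 𝒜]
    (Af : SmallFP 𝒜) :
    Af.nerve.IsEquivalence ∧
    Nonempty (Af.Transport Af.toMonadOn) ∧
    (∀ Φ : FinMnd 𝒜 ⥤ MonadOn Af.lex, Nonempty (Af.Transport Φ) →
      (SmallFP.viaCompletion Φ).IsEquivalence ∧
      Nonempty (SmallFP.viaCompletion Φ ≅ Af.nishizawaPower)) ∧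
    Af.nishizawaPower.IsEquivalence ∧
    ∃ e : SmallFP.viaCompletion Af.toMonadOn ≅ Af.nishizawaPower,
      ∀ (S : FinMnd 𝒜) (i j : Af.carrier) (f : Af.ι.obj j ⟶ S.obj.obj (Af.ι.obj i)),
        UnderId.Mor.map (e.hom.app S).hom (i := op i) (j := op j) f = f :=
  ⟨inferInstance, ⟨Af.restrTransport⟩,
    fun _ ⟨τ⟩ => ⟨Functor.isEquivalence_of_iso τ.viaCompletionIso.symm, ⟨τ.viaCompletionIso⟩⟩,
    inferInstance, Af.restrTransport.viaCompletionIso, Af.restrTransport_viaCompletionIso⟩
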